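/- Write points of $\mathbb R^2\times\mathbb R$ as $(\xi,\tau)$ (frequency side) or $(x,t)$ (physical side), let $\mathcal F^{-1}g(x,t)=(2\pi)^{-3}\int e^{i(x\cdot\xi+t\tau)}g(\xi,\tau)\,d\xi\,d\tau$ be the inverse Fourier transform on $L^2(\mathbb R^2\times\mathbb R)$, and put $P(\tau,\xi)=\tau+\xi_1^2-\xi_2^2$. For $\mathbf e=(e_1,e_2)\in\mathbb S^1$ let $\mathbf e^\perp=(-e_2,e_1)$ and $\overline{\mathbf e}=(e_1,-e_2)$, and for $p,q\in[1,\infty]$ let $$\|u\|_{L^{p,q}_{\mathbf e}}=\Big\|\,\big\|u(r\mathbf e+v\mathbf e^\perp,t)\big\|_{L^q_{v,t}(\mathbb R^2)}\Big\|_{L^p_r(\mathbb R)},\qquad u\in L^2(\mathbb R^2\times\mathbb R).$$ Fix a smooth even function $\eta_0:\mathbb R\to[0,1]$ supported in $\{|\mu|\le 2\}$ and equal to $1$ on $\{|\mu|\le 1/2\}$, and put $\eta_j(\mu)=\eta_0(\mu/2^j)-\eta_0(\mu/2^{j-1})$ for $j\ge1$. Fix also finitely many pairwise distinct directions $\mathbf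 e_1,\dots,\mathbf e_L\in\mathbb S^1$ such that every $\mathbf e\in\mathbb S^1$ is within distance $2^{-50}$ of some $\mathbf e_l$ and such that the family is closed under $\mathbf e\mapsto-\mathbf e$. For $k\in\{0,1,2,\dots\}$ let $D_{k,\infty}=\{(\xi,\tau):2^{k-1}\le|\xi|\le2^{k+1}\}$ if $k\ge1$, $D_{0,\infty}=\{(\xi,\tau):|\xi|\le2\}$, and $D^{\mathbf e}_{k,\infty}=\{(\xi,\tau)\in D_{k,\infty}:|\xi\cdot\overline{\mathbf e}|\ge|\xi|/2\}$. Let $X_k$ be the space of $f\in L^2(\mathbb R^2\times\mathbb R)$ supported in $D_{k,\infty}$ with $$\|f\|_{X_k}=\sum_{j=0}^\infty2^{j/2}\|\eta_j(P(\tau,\xi))f\|_{L^2}<\infty.$$ For $k\ge100$ let $Y_k^{\mathbf e}$ be the space of $f\in L^2(\mathbb R^2\times\mathbb R)$ supported in $D^{\mathbf e}_{k,\infty}$, with $(P(\tau,\xi)+i)f\in L^2$, such that $$\|f\|_{Y_k^{\mathbf e}}=2^{-k/2}\|\mathcal F^{-1}[(P(\tau,\xi)+i)f]\|_{L^{1,2}_{\mathbf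 e}}<\infty,$$ and let $Y_k^{\mathbf e}=\{0\}$ for $k\le99$. Let $Z_k=X_k+Y_k^{\mathbf e_1}+\dots+Y_k^{\mathbf e_L}$, with the norm $$\|f\|_{Z_k}=\inf\Big\{\|f_0\|_{X_k}+\sum_{l=1}^L\|f_l\|_{Y_k^{\mathbf e_l}}: f=f_0+f_1+\dots+f_L,\ f_0\in X_k,\ f_l\in Y_k^{\mathbf e_l}\Big\}.$$ Then there is a constant $C$, independent of $k$, $\mathbf e$ and $f$, such that for all $k\in\{0,1,2,\dots\}$, all $\mathbf e\in\mathbb S^1$ and all $f\in Z_k$, $$\|1_{[-2,2]}(t)\cdot\mathcal F^{-1}(f)\|_{L^{2,\infty}_{\mathbf e}}\le C\,2^{k/2}(k+1)^2\|f\|_{Z_k}.$$ -/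

import Mathlib

open MeasureTheory Set FourierTransform
open scoped ENNReal NNReal

namespace MaximalEstimate

noncomputable section

/-- The plane with its Euclidean norm. -/
abbrev Plane : Type := EuclideanSpace ℝ (Fin 2)

/-- `ℝ² × ℝ` as a Euclidean space; its points are `(ξ, τ)` on the frequency side and `(x, t)` on
the physical side, with `fst` in the plane and `snd` in the line. -/
abbrev SpaceTime : Type := WithLp 2 (Plane × ℝ)

/-- `L²(ℝ² × ℝ)`, complex valued. -/
abbrev L2 : Type := Lp ℂ 2 (volume : Measure SpaceTime)

/-- The unit circle. -/
abbrev Circle1 : Type := Metric.sphere (0 : Plane) 1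

/-- The rotation `(v₁, v₂) ↦ (-v₂, v₁)`. -/
def perp (v : Plane) : Plane := !₂[-v 1, v 0]

/-- The reflection `(v₁, v₂) ↦ (v₁, -v₂)`. -/
def conj (v : Plane) : Plane := !₂[v 0, -v 1]

/-- The symbol `P(τ, ξ) = τ + ξ₁² - ξ₂²`. -/
def symb (y : SpaceTime) : ℝ := y.snd + (y.fst 0) ^ 2 - (y.fst 1) ^ 2

/-- The admissible cut-off functions `η₀`. -/
structure IsCutoff (η : ℝ → ℝ) : Prop where
  smooth : ContDiff ℝ ((⊤ : ℕ∞) : WithTop ℕ∞) η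
  even : ∀ s, η (-s) = η s
  range : ∀ s, η s ∈ Icc (0 : ℝ) 1
  supp : Function.support η ⊆ {s | |s| ≤ 2}
  one : ∀ s, |s| ≤ 1 / 2 → η s = 1

/-- The dyadic pieces: `η₀` for `j = 0`, and `η₀(s / 2^j) - η₀(s / 2^(j-1))` for `j ≥ 1`. -/
def dyadic (η : ℝ → ℝ) : ℕ → ℝ → ℝ
  | 0 => η
  | j + 1 => fun s => η (s / 2 ^ (j + 1)) - η (s / 2 ^ j)

/-- The admissible finite families of directions. -/
structure IsDirectionNet {L : ℕ} (ev : Fin L → Circle1) : Prop where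
  injective : Function.Injective ev
  dense : ∀ e : Circle1, ∃ l, ‖(ev l : Plane) - (e : Plane)‖ ≤ (2 : ℝ)⁻¹ ^ 50
  symm : ∀ l, ∃ l', ev l' = -ev l

/-- The sets `D_{k,j}`. -/
def regionD (k j : ℕ) : Set SpaceTime :=
  {y | (if k = 0 then ‖y.fst‖ ≤ 2 else ‖y.fst‖ ∈ Icc ((2 : ℝ) ^ (k - 1)) (2 ^ (k + 1))) ∧
    |symb y| ≤ 2 ^ (j + 1)}

/-- The sets `D_{k,∞}`. -/
def regionDTop (k : ℕ) : Set SpaceTime := ⋃ j, regionD k j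

/-- The sets `D_{k,∞}^e`. -/
def regionDTopDir (k : ℕ) (e : Plane) : Set SpaceTime :=
  {y ∈ regionDTop k | ‖y.fst‖ / 2 ≤ |inner ℝ y.fst (conj e)|}

/-- The mixed norm of `L^{p,q}_e`: the `L^p` norm in `r` of the `L^q` norm in `(v, t)` of
`f (r e + v e^⊥, t)`. -/
def mixedNorm (p q : ℝ≥0∞) (e : Plane) (f : SpaceTime → ℂ) : ℝ≥0∞ :=
  eLpNorm (fun r : ℝ =>
    eLpNorm (fun z : ℝ × ℝ => f (WithLp.toLp 2 (r • e + z.1 • perp e, z.2))) q volume) p volume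

/-- The inverse Fourier transform `(2π)⁻³ ∫ e^{i (x·ξ + tτ)} g(ξ, τ) dξ dτ` on `L²(ℝ² × ℝ)`.
Mathlib's `𝓕⁻` has the kernel `e^{2πi ⟨x, ξ⟩}`, hence the dilation. -/
def invFourier (g : L2) : SpaceTime → ℂ :=
  fun y => ((2 * Real.pi : ℝ) ^ 3 : ℂ)⁻¹ * (𝓕⁻ g : L2) ((2 * Real.pi)⁻¹ • y)

/-- The `X_k` norm (it does not depend on `k`). -/
def normX (η : ℝ → ℝ) (f : L2) : ℝ≥0∞ :=
  ∑' j : ℕ, (2 : ℝ≥0∞) ^ ((j : ℝ) / 2) *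
    eLpNorm (fun y => (dyadic η j (symb y) : ℂ) * f y) 2 volume

/-- The space `X_k`. Since `D_{k,∞}` is closed, `supp f ⊆ D_{k,∞}` means that `f` vanishes almost
everywhere outside of it. -/
def spaceX (η : ℝ → ℝ) (k : ℕ) : Set L2 :=
  {f | (∀ᵐ y : SpaceTime, y ∉ regionDTop k → f y = 0) ∧ normX η f < ∞}

open Classical in
/-- The `Y_k^e` norm. The space `L^{1,2}_e` consists of `L²` functions, so that the norm is infinite
unless `(P + i) f` is in `L²`. -/
def normY (k : ℕ) (e : Plane) (f : L2) : ℝ≥0∞ :=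
  if h : MemLp (fun y => ((symb y : ℂ) + Complex.I) * f y) 2 (volume : Measure SpaceTime) then
    (2 : ℝ≥0∞) ^ (-(k : ℝ) / 2) * mixedNorm 1 2 e (invFourier h.toLp)
  else ∞

/-- The space `Y_k^e`, which is zero for `k ≤ 99`. -/
def spaceY (k : ℕ) (e : Plane) : Set L2 :=
  if 100 ≤ k then
    {f | (∀ᵐ y : SpaceTime, y ∉ regionDTopDir k e → f y = 0) ∧ normY k e f < ∞}
  else {0}

/-- `f = f₀ + ∑ₗ fₗ` with `f₀ ∈ X_k` and `fₗ ∈ Y_k^{e_l}`. -/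
def IsDecomp (η : ℝ → ℝ) {L : ℕ} (ev : Fin L → Circle1) (k : ℕ) (f f₀ : L2) (fl : Fin L → L2) :
    Prop :=
  f₀ ∈ spaceX η k ∧ (∀ l, fl l ∈ spaceY k (ev l)) ∧ f = f₀ + ∑ l, fl l

/-- The space `Z_k = X_k + Y_k^{e_1} + ⋯ + Y_k^{e_L}`. -/
def spaceZ (η : ℝ → ℝ) {L : ℕ} (ev : Fin L → Circle1) (k : ℕ) : Set L2 :=
  {f | ∃ f₀ fl, IsDecomp η ev k f f₀ fl}

/-- The norm of the sum of spaces `Z_k`: the infimum over all decompositions. -/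
def normZ (η : ℝ → ℝ) {L : ℕ} (ev : Fin L → Circle1) (k : ℕ) (f : L2) : ℝ≥0∞ :=
  ⨅ (f₀ : L2) (fl : Fin L → L2) (_ : IsDecomp η ev k f f₀ fl),
    normX η f₀ + ∑ l, normY k (ev l) (fl l)

end

end MaximalEstimate

/-! The whole space `Z_k` embeds in `X_k` with a loss of a factor `k + 1`, and the maximal estimate
holds in `X_k` with another such loss. Since `f` itself then lies in `X_k`, the maximal function is
estimated only once, with no splitting of the inverse Fourier transform.

For the `X_k` estimate, take a piece with `|ξ| ≤ 2N`, `N = 2^k`, and `|P| ≤ δ`. The supremum over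
`(v, t)` is linearized by a measurable choice of point for each `r`
(`lintegral_iSup_le_of_selection`), and the linear operator is treated by `T T*`
(`lintegral_enorm_integral_sq_le`). With a Gaussian as frequency cut-off the kernel is explicit, and
for `|t - t'| ≤ 4` it is bounded by a multiple of `δ min (N², N / |r|, N² / r²)`, uniformly in the
chosen points (`gaussian_kernel_le_profile`). Its integral in `r` is of order `δ N (k + 1)`; the
logarithm comes from `N / |r|` on `1 / N ≤ |r| ≤ N`. With `δ` of size `2^j` the square root produces
exactly the weight `2^{j/2}` of `X_k`, and the pieces are summed (`mixedNorm_two_top_le_normX`).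

For the embedding of `Y_k^e`, fix the frequency coordinates orthogonal to `e`. Along `e` the symbol
has derivative `2 ξ · conj e`, of size at least about `N`, so the slices of `{|P| ≲ 2^j}` have
length at most about `2^j / N`, and never more than about `N`. Duality between `L^{1,2}_e` and
`L^{∞,2}_e` converts slice length into an `L²` bound (`eLpNorm_indicator_le_mixedNorm`). Dividing by
`|P + i| ≳ 2^j`, every `j ≤ 2k` contributes the same amount to the `X_k` norm and the rest decays
geometrically, whence the factor `k + 1` (`normX_le_of_mem_spaceY`). -/

/-! ### The inverse Fourier transform on `L²` and its integral formula -/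

section FourierInverse

variable {V : Type*} [NormedAddCommGroup V] [InnerProductSpace ℝ V] [FiniteDimensional ℝ V]
  [MeasurableSpace V] [BorelSpace V]

open SchwartzMap in
/-- On integrable functions in `L²`, the inverse Fourier transform of `L²` is given by the
integral. -/
theorem MeasureTheory.Lp.fourierInv_ae_eq_of_integrable (f : Lp ℂ 2 (volume : Measure V))
    (hf : Integrable f) : (𝓕⁻ f : Lp ℂ 2 (volume : Measure V)) =ᵐ[volume] 𝓕⁻ (f : V → ℂ) := by
  have hcont : Continuous (𝓕⁻ (f : V → ℂ)) :=
    VectorFourier.fourierIntegral_continuous Real.continuous_fourierChar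
      (by simp only [LinearMap.neg_apply, innerₗ_apply_apply]; fun_prop) hf
  refine ae_eq_of_integral_contDiff_smul_eq
    ((Lp.memLp _).locallyIntegrable one_le_two) hcont.locallyIntegrable fun g hg hgs => ?_
  have hgs' : HasCompactSupport (fun x => (g x : ℂ)) :=
    hgs.comp_left (g := fun t : ℝ => (t : ℂ)) rfl
  have hg' : ContDiff ℝ ((⊤ : ℕ∞) : WithTop ℕ∞) (fun x => (g x : ℂ)) :=
    Complex.ofRealCLM.contDiff.comp hg
  let φ : 𝓢(V, ℂ) := hgs'.toSchwartzMap hg'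
  -- Both candidates are tested against `φ`: the `L²` transform through tempered distributions, the
  -- integral through Fubini.
  have h1 : (𝓕⁻ (f : 𝓢'(V, ℂ))) φ = ((𝓕⁻ f : Lp ℂ 2 (volume : Measure V)) : 𝓢'(V, ℂ)) φ := by
    rw [Lp.fourierInv_toTemperedDistribution_eq]
  rw [TemperedDistribution.fourierInv_apply, Lp.toTemperedDistribution_apply,
    Lp.toTemperedDistribution_apply] at h1
  have h2 := VectorFourier.integral_fourierIntegral_smul_eq_flip (μ := volume) (ν := volume)
    (L := -innerₗ V) (f := φ) (g := f) Real.continuous_fourierChar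
    (by simp only [LinearMap.neg_apply, innerₗ_apply_apply]; fun_prop) φ.integrable hf
  have hflip : (-innerₗ V).flip = -innerₗ V := by
    ext x y
    simp [real_inner_comm]
  rw [hflip] at h2
  calc ∫ x, g x • (𝓕⁻ f : Lp ℂ 2 (volume : Measure V)) x
      = ∫ x, φ x • (𝓕⁻ f : Lp ℂ 2 (volume : Measure V)) x := by
        refine integral_congr_ae (.of_forall fun x => ?_)
        simp [φ]
    _ = ∫ x, (𝓕⁻ φ) x • f x := h1.symm
    _ = ∫ x, φ x • (𝓕⁻ (f : V → ℂ)) x := by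
        rw [SchwartzMap.fourierInv_coe]
        exact h2
    _ = _ := by
        refine integral_congr_ae (.of_forall fun x => ?_)
        simp [φ]

theorem MeasureTheory.Lp.norm_fourierInv_eq (f : Lp ℂ 2 (volume : Measure V)) :
    ‖(𝓕⁻ f : Lp ℂ 2 (volume : Measure V))‖ = ‖f‖ :=
  (Lp.fourierTransformₗᵢ V ℂ).symm.norm_map f

theorem MeasureTheory.Lp.inner_fourierInv_eq (f g : Lp ℂ 2 (volume : Measure V)) :
    inner ℂ (𝓕⁻ f : Lp ℂ 2 (volume : Measure V)) (𝓕⁻ g) = inner ℂ f g :=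
  (Lp.fourierTransformₗᵢ V ℂ).symm.inner_map_map f g

/-- Plancherel's identity for the integral formula of the inverse Fourier transform. -/
theorem eLpNorm_fourierInv_eq {f : V → ℂ} (hf : Integrable f) (hf2 : MemLp f 2 volume) :
    eLpNorm (𝓕⁻ f) 2 volume = eLpNorm f 2 volume := by
  have hae := hf2.coeFn_toLp
  have h1 := Lp.fourierInv_ae_eq_of_integrable hf2.toLp ((integrable_congr hae).2 hf)
  have h2 : 𝓕⁻ (hf2.toLp : V → ℂ) = 𝓕⁻ f := funext fun x => Real.fourierInv_congr_ae hae x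
  rw [← h2, ← eLpNorm_congr_ae h1, ← eLpNorm_congr_ae hae, ← Lp.enorm_def, ← Lp.enorm_def,
    ← ofReal_norm, ← ofReal_norm, Lp.norm_fourierInv_eq]

end FourierInverse

/-! ### Coordinates adapted to a direction and to the symbol -/

namespace MaximalEstimate

noncomputable section

/-- The coordinates `(r, (v, t)) ↦ (r e + v e^⊥, t)`. -/
def coord (e : Plane) (p : ℝ × (ℝ × ℝ)) : SpaceTime :=
  WithLp.toLp 2 (p.1 • e + p.2.1 • perp e, p.2.2)

theorem mixedNorm_eq (p q : ℝ≥0∞) (e : Plane) (f : SpaceTime → ℂ) :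
    mixedNorm p q e f =
      eLpNorm (fun r : ℝ => eLpNorm (fun z : ℝ × ℝ => f (coord e (r, z))) q volume) p volume := rfl

theorem norm_sq_eq (v : Plane) : ‖v‖ ^ 2 = v 0 ^ 2 + v 1 ^ 2 := by
  rw [EuclideanSpace.norm_sq_eq, Fin.sum_univ_two]
  simp

theorem continuous_coord (e : Plane) : Continuous (coord e) := by
  unfold coord
  fun_prop

theorem coord_smul (e : Plane) (a : ℝ) (p : ℝ × (ℝ × ℝ)) : coord e (a • p) = a • coord e p := by
  simp [coord, ← WithLp.toLp_smul, mul_smul]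

theorem coord_sub (e : Plane) (p q : ℝ × (ℝ × ℝ)) : coord e (p - q) = coord e p - coord e q := by
  simp only [coord, ← WithLp.toLp_sub, Prod.mk_sub_mk, Prod.fst_sub, Prod.snd_sub, sub_smul]
  congr 2
  abel

@[simp] theorem coord_fst_zero (e : Plane) (p : ℝ × (ℝ × ℝ)) :
    (coord e p).fst 0 = p.1 * e 0 - p.2.1 * e 1 := by
  simp [coord, perp, sub_eq_add_neg]

@[simp] theorem coord_fst_one (e : Plane) (p : ℝ × (ℝ × ℝ)) :
    (coord e p).fst 1 = p.1 * e 1 + p.2.1 * e 0 := by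
  simp [coord, perp]

@[simp] theorem coord_snd (e : Plane) (p : ℝ × (ℝ × ℝ)) : (coord e p).snd = p.2.2 := rfl

theorem inner_spaceTime (x y : SpaceTime) :
    inner ℝ x y = x.fst 0 * y.fst 0 + x.fst 1 * y.fst 1 + x.snd * y.snd := by
  rw [WithLp.prod_inner_apply, PiLp.inner_apply, Fin.sum_univ_two]
  simp [mul_comm]

variable {e : Plane}

theorem norm_sq_coord_fst (he : ‖e‖ = 1) (p : ℝ × (ℝ × ℝ)) :
    ‖(coord e p).fst‖ ^ 2 = p.1 ^ 2 + p.2.1 ^ 2 := by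
  have h := norm_sq_eq e
  rw [he] at h
  rw [norm_sq_eq, coord_fst_zero, coord_fst_one]
  linear_combination (-p.1 ^ 2 - p.2.1 ^ 2) * h

theorem inner_coord_coord (he : ‖e‖ = 1) (p q : ℝ × (ℝ × ℝ)) :
    inner ℝ (coord e p) (coord e q) = p.1 * q.1 + p.2.1 * q.2.1 + p.2.2 * q.2.2 := by
  have h := norm_sq_eq e
  rw [he] at h
  simp only [inner_spaceTime, coord_fst_zero, coord_fst_one, coord_snd]
  linear_combination (-p.1 * q.1 - p.2.1 * q.2.1) * h

theorem coord_injective (he : ‖e‖ = 1) : Function.Injective (coord e) := by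
  intro p q h
  have h1 : coord e (p - q) = 0 := by rw [coord_sub, h, sub_self]
  have h2 := inner_coord_coord he (p - q) (p - q)
  rw [h1, inner_self_eq_zero.2 rfl] at h2
  rw [← sub_eq_zero]
  ext
  · change (p - q).1 = 0
    nlinarith [sq_nonneg (p - q).1, sq_nonneg (p - q).2.1, sq_nonneg (p - q).2.2]
  · change (p - q).2.1 = 0
    nlinarith [sq_nonneg (p - q).1, sq_nonneg (p - q).2.1, sq_nonneg (p - q).2.2]
  · change (p - q).2.2 = 0
    nlinarith [sq_nonneg (p - q).1, sq_nonneg (p - q).2.1, sq_nonneg (p - q).2.2]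

theorem measurableEmbedding_coord (he : ‖e‖ = 1) : MeasurableEmbedding (coord e) :=
  (continuous_coord e).measurable.measurableEmbedding (coord_injective he)

/-- The rotation of the plane that takes the first basis vector to `e`. -/
def rotation (e : Plane) (he : ‖e‖ = 1) : Plane →ₗᵢ[ℝ] Plane where
  toFun x := x 0 • e + x 1 • perp e
  map_add' x y := by simp [add_smul]; abel
  map_smul' a x := by simp [mul_smul]
  norm_map' x := by
    have h := norm_sq_eq e
    rw [he] at h
    rw [← sq_eq_sq₀ (norm_nonneg _) (norm_nonneg _), norm_sq_eq, norm_sq_eq]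
    simp [perp]
    linear_combination (-x 0 ^ 2 - x 1 ^ 2) * h

theorem measurePreserving_coord (he : ‖e‖ = 1) : MeasurePreserving (coord e) := by
  have h1 : MeasurePreserving
      ((rotation e he).toLinearIsometryEquiv rfl) (volume : Measure Plane) volume :=
    LinearIsometryEquiv.measurePreserving _
  have h2 : MeasurePreserving (fun x : ℝ × ℝ => (WithLp.toLp 2 ![x.1, x.2] : Plane)) :=
    (PiLp.volume_preserving_toLp (Fin 2)).comp (volume_preserving_finTwoArrow ℝ).symm
  have h3 := (h1.comp h2).prod (MeasurePreserving.id (volume : Measure ℝ))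
  have h4 : MeasurePreserving (MeasurableEquiv.prodAssoc (α := ℝ) (β := ℝ) (γ := ℝ)).symm :=
    volume_preserving_prodAssoc.symm
  have h5 := (WithLp.volume_preserving_toLp Plane ℝ).comp (h3.comp h4)
  exact h5

theorem ae_ae_coord (he : ‖e‖ = 1) {P : SpaceTime → Prop} (h : ∀ᵐ y, P y) :
    ∀ᵐ r : ℝ, ∀ᵐ z : ℝ × ℝ, P (coord e (r, z)) :=
  Measure.ae_ae_of_ae_prod ((measurePreserving_coord he).quasiMeasurePreserving.ae h)

theorem mixedNorm_congr_ae (he : ‖e‖ = 1) {p q : ℝ≥0∞} {f g : SpaceTime → ℂ}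
    (h : f =ᵐ[volume] g) : mixedNorm p q e f = mixedNorm p q e g := by
  rw [mixedNorm_eq, mixedNorm_eq]
  refine eLpNorm_congr_ae ?_
  filter_upwards [ae_ae_coord he h] with r hr
  exact eLpNorm_congr_ae hr

/-- The coordinates `(ξ₁, (ξ₂, μ)) ↦ (ξ, μ - ξ₁² + ξ₂²)`, in which the symbol is `μ`. -/
def shear (p : ℝ × (ℝ × ℝ)) : SpaceTime :=
  WithLp.toLp 2 (!₂[p.1, p.2.1], p.2.2 - p.1 ^ 2 + p.2.1 ^ 2)

@[simp] theorem shear_fst_zero (p : ℝ × (ℝ × ℝ)) : (shear p).fst 0 = p.1 := rfl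

@[simp] theorem shear_fst_one (p : ℝ × (ℝ × ℝ)) : (shear p).fst 1 = p.2.1 := rfl

@[simp] theorem shear_snd (p : ℝ × (ℝ × ℝ)) : (shear p).snd = p.2.2 - p.1 ^ 2 + p.2.1 ^ 2 := rfl

@[simp] theorem symb_shear (p : ℝ × (ℝ × ℝ)) : symb (shear p) = p.2.2 := by
  simp only [symb, shear_fst_zero, shear_fst_one, shear_snd]
  ring

theorem continuous_shear : Continuous shear := by
  unfold shear
  fun_prop

theorem shear_injective : Function.Injective shear := by
  intro p q h
  have h0 : p.1 = q.1 := by simpa using congrArg (fun y : SpaceTime => y.fst 0) h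
  have h1 : p.2.1 = q.2.1 := by simpa using congrArg (fun y : SpaceTime => y.fst 1) h
  have h2 : p.2.2 = q.2.2 := by simpa using congrArg symb h
  ext <;> assumption

theorem measurableEmbedding_shear : MeasurableEmbedding shear :=
  continuous_shear.measurable.measurableEmbedding shear_injective

/-- For fixed `ξ` the map is a translation in the last variable, so it is a skew product over the
identity. -/
theorem measurePreserving_shear : MeasurePreserving shear := by
  have h1 : MeasurePreserving
      (fun p : (ℝ × ℝ) × ℝ => (p.1, p.2 + (p.1.2 ^ 2 - p.1.1 ^ 2)))
      (volume.prod volume) (volume.prod volume) :=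
    (MeasurePreserving.id (volume : Measure (ℝ × ℝ))).skew_product
      (g := fun (a : ℝ × ℝ) (c : ℝ) => c + (a.2 ^ 2 - a.1 ^ 2)) (by fun_prop)
      (.of_forall fun a => map_add_right_eq_self volume _)
  have h4 : MeasurePreserving (MeasurableEquiv.prodAssoc (α := ℝ) (β := ℝ) (γ := ℝ)).symm :=
    volume_preserving_prodAssoc.symm
  have h2 : MeasurePreserving (fun x : ℝ × ℝ => (WithLp.toLp 2 ![x.1, x.2] : Plane)) :=
    (PiLp.volume_preserving_toLp (Fin 2)).comp (volume_preserving_finTwoArrow ℝ).symm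
  have h3 := h2.prod (MeasurePreserving.id (volume : Measure ℝ))
  have h5 := (WithLp.volume_preserving_toLp Plane ℝ).comp (h3.comp (h1.comp h4))
  have h6 : shear = WithLp.toLp 2 ∘ Prod.map (fun x : ℝ × ℝ => (WithLp.toLp 2 ![x.1, x.2] : Plane))
      id ∘ (fun p : (ℝ × ℝ) × ℝ => (p.1, p.2 + (p.1.2 ^ 2 - p.1.1 ^ 2))) ∘
        (MeasurableEquiv.prodAssoc (α := ℝ) (β := ℝ) (γ := ℝ)).symm := by
    funext p
    have h7 : p.2.2 - p.1 ^ 2 + p.2.1 ^ 2 = p.2.2 + (p.2.1 ^ 2 - p.1 ^ 2) := by ring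
    rw [shear, h7]
    rfl
  rw [h6]
  exact h5

/-- The set of frequencies `(ξ, τ)` with `|ξ| ≤ R` and `|P(τ, ξ)| ≤ δ`. -/
def box (R δ : ℝ) : Set SpaceTime := {y | ‖y.fst‖ ≤ R ∧ |symb y| ≤ δ}

theorem continuous_symb : Continuous symb := by
  unfold symb
  fun_prop

theorem measurableSet_box (R δ : ℝ) : MeasurableSet (box R δ) :=
  have h1 : IsClosed {y : SpaceTime | ‖y.fst‖ ≤ R} := isClosed_le (by fun_prop) continuous_const
  (h1.inter (isClosed_le continuous_symb.abs continuous_const)).measurableSet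

theorem volume_box_le {R δ : ℝ} (hR : 0 ≤ R) :
    volume (box R δ) ≤ ENNReal.ofReal (8 * R ^ 2 * δ) := by
  rw [← measurePreserving_shear.measure_preimage_emb measurableEmbedding_shear]
  calc volume (shear ⁻¹' box R δ)
      ≤ volume (Icc (-R) R ×ˢ (Icc (-R) R ×ˢ Icc (-δ) δ)) := by
        refine measure_mono fun p hp => ?_
        obtain ⟨h1, h2⟩ := hp
        rw [symb_shear] at h2
        have h3 := norm_sq_eq (shear p).fst
        rw [shear_fst_zero, shear_fst_one] at h3
        have h4 : ‖(shear p).fst‖ ^ 2 ≤ R ^ 2 := pow_le_pow_left₀ (norm_nonneg _) h1 2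
        exact ⟨abs_le.1 (abs_le_of_sq_le_sq (by nlinarith) hR),
          abs_le.1 (abs_le_of_sq_le_sq (by nlinarith) hR), abs_le.1 h2⟩
    _ = ENNReal.ofReal (8 * R ^ 2 * δ) := by
        rw [Measure.volume_eq_prod, Measure.prod_prod, Measure.volume_eq_prod, Measure.prod_prod,
          Real.volume_Icc, Real.volume_Icc, ← ENNReal.ofReal_mul (by linarith),
          ← ENNReal.ofReal_mul (by linarith)]
        congr 1
        ring

end

end MaximalEstimate

/-! ### The `T T*` argument -/

section Duality

open ComplexConjugate

variable {Ω X : Type*} [MeasurableSpace Ω] [MeasurableSpace X] {ν : Measure Ω} {μ : Measure X}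

theorem sq_lintegral_mul_le {f g : X → ℝ≥0∞} (hf : AEMeasurable f μ) (hg : AEMeasurable g μ) :
    (∫⁻ x, f x * g x ∂μ) ^ 2 ≤ (∫⁻ x, f x ^ 2 ∂μ) * ∫⁻ x, g x ^ 2 ∂μ := by
  have h := ENNReal.lintegral_mul_le_Lp_mul_Lq μ Real.HolderConjugate.two_two hf hg
  simp only [ENNReal.rpow_two] at h
  calc (∫⁻ x, f x * g x ∂μ) ^ 2
      ≤ ((∫⁻ x, f x ^ 2 ∂μ) ^ (1 / 2 : ℝ) * (∫⁻ x, g x ^ 2 ∂μ) ^ (1 / 2 : ℝ)) ^ 2 := by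
        gcongr
        exact h
    _ = _ := by
        rw [mul_pow, ← ENNReal.rpow_two, ← ENNReal.rpow_two, ← ENNReal.rpow_mul,
          ← ENNReal.rpow_mul]
        norm_num

theorem eLpNorm_two_sq {E : Type*} [NormedAddCommGroup E] (f : X → E) :
    eLpNorm f 2 μ ^ 2 = ∫⁻ x, ‖f x‖ₑ ^ 2 ∂μ := by
  simpa using eLpNorm_nnreal_pow_eq_lintegral (f := f) (p := 2) (μ := μ) two_ne_zero

theorem enorm_integral_conj_mul_self {f : X → ℂ} (hf : MemLp f 2 μ) :
    ‖∫ x, conj (f x) * f x ∂μ‖ₑ = ∫⁻ x, ‖f x‖ₑ ^ 2 ∂μ := by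
  have h1 : ∫ x, conj (f x) * f x ∂μ = ((∫ x, ‖f x‖ ^ 2 ∂μ : ℝ) : ℂ) := by
    rw [← integral_complex_ofReal]
    simp [Complex.conj_mul']
  have h2 : Integrable (fun x => ‖f x‖ ^ 2) μ := hf.integrable_norm_pow two_ne_zero
  rw [h1, ← ofReal_norm, Complex.norm_real, Real.norm_of_nonneg (by positivity),
    ofReal_integral_eq_lintegral_ofReal h2 (.of_forall fun x => by positivity)]
  simp [ENNReal.ofReal_pow]

/-- With `v = ∫ conj (T r) a r dν`, the quantity `A = ‖T‖²` equals `∫ v F`, so `A² ≤ ‖v‖² ‖F‖²`.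
Expanding `‖v‖²` brings in the kernel of `T T*`, and Schur's test gives `‖v‖² ≤ 2 B A`. Dividing by
`A` requires `A < ∞`, which is ensured by finiteness of `ν` and the uniform bound on `T`. -/
theorem lintegral_enorm_integral_sq_le_of_isFiniteMeasure [IsFiniteMeasure ν] [SFinite μ]
    {a : Ω → X → ℂ} (ha : Measurable (Function.uncurry a)) {w : X → ℝ} (hw : MemLp w 2 μ)
    (hb : ∀ r x, ‖a r x‖ ≤ w x) {κ : Ω → Ω → ℝ≥0∞} (hκm : Measurable (Function.uncurry κ))
    (hκs : ∀ r r', κ r r' = κ r' r) (hκ : ∀ r r', ‖∫ x, a r x * conj (a r' x) ∂μ‖ₑ ≤ κ r r')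
    {B : ℝ≥0∞} (hB : ∀ r, ∫⁻ r', κ r r' ∂ν ≤ B) {F : X → ℂ} (hF : MemLp F 2 μ) :
    ∫⁻ r, ‖∫ x, a r x * F x ∂μ‖ₑ ^ 2 ∂ν ≤ 2 * B * ∫⁻ x, ‖F x‖ₑ ^ 2 ∂μ := by
  have hwF : Integrable (fun x => w x * ‖F x‖) μ := hw.integrable_mul hF.norm
  have hw2 : Integrable (fun x => w x ^ 2) μ := hw.integrable_sq
  set T : Ω → ℂ := fun r => ∫ x, a r x * F x ∂μ with hT
  set c : ℝ := ∫ x, w x * ‖F x‖ ∂μ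
  have hTc : ∀ r, ‖T r‖ ≤ c := fun r => by
    refine norm_integral_le_of_norm_le hwF (.of_forall fun x => ?_)
    rw [norm_mul]
    exact mul_le_mul_of_nonneg_right (hb r x) (norm_nonneg _)
  have hTm : AEStronglyMeasurable T ν :=
    AEStronglyMeasurable.integral_prod_right' (f := fun p : Ω × X => a p.1 p.2 * F p.2)
      (ha.aestronglyMeasurable.mul hF.1.comp_snd)
  have hT2 : MemLp T 2 ν := MemLp.of_bound hTm c (.of_forall hTc)
  set A := ∫⁻ r, ‖T r‖ₑ ^ 2 ∂ν with hA
  have hAtop : A ≠ ∞ := by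
    rw [hA, ← eLpNorm_two_sq]
    exact ENNReal.pow_ne_top hT2.2.ne
  have hgm : AEStronglyMeasurable (fun r => conj (T r)) ν :=
    Complex.continuous_conj.comp_aestronglyMeasurable hTm
  have hbm : AEStronglyMeasurable (fun p : X × Ω => conj (T p.2) * a p.2 p.1) (μ.prod ν) :=
    hgm.comp_snd.mul (ha.comp measurable_swap).aestronglyMeasurable
  set v : X → ℂ := fun x => ∫ r, conj (T r) * a r x ∂ν with hv
  have hbd : ∀ r x, ‖conj (T r) * a r x‖ ≤ c * w x := fun r x => by
    rw [norm_mul, RCLike.norm_conj]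
    exact mul_le_mul (hTc r) (hb r x) (norm_nonneg _) ((norm_nonneg _).trans (hTc r))
  have hvm : AEStronglyMeasurable v μ := hbm.integral_prod_right'
  have hv2 : MemLp v 2 μ := by
    refine (hw.const_mul (c * (ν.real univ))).of_le hvm (.of_forall fun x => ?_)
    calc ‖v x‖ ≤ (c * w x) * ν.real univ := norm_integral_le_of_norm_le_const
          (.of_forall fun r => hbd r x)
      _ ≤ ‖c * ν.real univ * w x‖ := by
          rw [Real.norm_eq_abs]
          refine le_trans (le_of_eq ?_) (le_abs_self _)
          ring
  have hvF : ∫ r, conj (T r) * T r ∂ν = ∫ x, v x * F x ∂μ := by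
    have hintg : Integrable (Function.uncurry fun r x => conj (T r) * (a r x * F x))
        (ν.prod μ) := by
      refine ((integrable_const (μ := ν) c).mul_prod hwF).mono'
        (hgm.comp_fst.mul (ha.aestronglyMeasurable.mul hF.1.comp_snd)) (.of_forall fun p => ?_)
      simp only [Function.uncurry]
      rw [← mul_assoc, norm_mul, ← mul_assoc]
      exact mul_le_mul_of_nonneg_right (hbd _ _) (norm_nonneg _)
    calc ∫ r, conj (T r) * T r ∂ν = ∫ r, ∫ x, conj (T r) * (a r x * F x) ∂μ ∂ν := by
          simp_rw [integral_const_mul, hT]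
      _ = ∫ x, ∫ r, conj (T r) * (a r x * F x) ∂ν ∂μ := integral_integral_swap hintg
      _ = ∫ x, v x * F x ∂μ := by
          simp_rw [← mul_assoc, integral_mul_const, hv]
  have hV : ∫⁻ x, ‖v x‖ₑ ^ 2 ∂μ ≤ 2 * B * A := by
    have hintg : Integrable (Function.uncurry fun (x : X) (z : Ω × Ω) =>
        (conj (T z.1) * a z.1 x) * conj (conj (T z.2) * a z.2 x)) (μ.prod (ν.prod ν)) := by
      refine (hw2.mul_prod (integrable_const (μ := ν.prod ν) (c ^ 2))).mono' ?_
        (.of_forall fun p => ?_)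
      · have h1 : AEStronglyMeasurable (fun p : X × (Ω × Ω) => conj (T p.2.1) * a p.2.1 p.1)
            (μ.prod (ν.prod ν)) :=
          (hgm.comp_fst.comp_snd).mul (ha.comp
            ((measurable_fst.comp measurable_snd).prodMk measurable_fst)).aestronglyMeasurable
        have h2 : AEStronglyMeasurable (fun p : X × (Ω × Ω) => conj (T p.2.2) * a p.2.2 p.1)
            (μ.prod (ν.prod ν)) :=
          (hgm.comp_snd.comp_snd).mul (ha.comp
            ((measurable_snd.comp measurable_snd).prodMk measurable_fst)).aestronglyMeasurable
        exact h1.mul (Complex.continuous_conj.comp_aestronglyMeasurable h2)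
      · simp only [Function.uncurry]
        rw [norm_mul, RCLike.norm_conj]
        calc _ ≤ (c * w p.1) * (c * w p.1) :=
              mul_le_mul (hbd _ _) (hbd _ _) (norm_nonneg _) ((norm_nonneg _).trans (hbd p.2.1 _))
          _ = _ := by ring
    have h1 : ∫ x, conj (v x) * v x ∂μ = ∫ z : Ω × Ω, (conj (T z.1) * T z.2) *
        ∫ x, a z.1 x * conj (a z.2 x) ∂μ ∂(ν.prod ν) := by
      calc ∫ x, conj (v x) * v x ∂μ
          = ∫ x, ∫ z : Ω × Ω, (conj (T z.1) * a z.1 x) * conj (conj (T z.2) * a z.2 x)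
              ∂(ν.prod ν) ∂μ := by
            refine integral_congr_ae (.of_forall fun x => ?_)
            simp only
            rw [integral_prod_mul (fun r => conj (T r) * a r x)
              (fun r => conj (conj (T r) * a r x)), integral_conj, mul_comm]
        _ = ∫ z : Ω × Ω, ∫ x, (conj (T z.1) * a z.1 x) * conj (conj (T z.2) * a z.2 x) ∂μ
              ∂(ν.prod ν) := integral_integral_swap hintg
        _ = _ := by
            refine integral_congr_ae (.of_forall fun z => ?_)
            simp only
            rw [← integral_const_mul]
            refine integral_congr_ae (.of_forall fun x => ?_)
            simp only [map_mul, Complex.conj_conj]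
            ring
    have hTe : AEMeasurable (fun r => ‖T r‖ₑ ^ 2) ν := hTm.enorm.pow_const 2
    have hκr : ∀ r, Measurable (κ r) := fun r => hκm.comp measurable_prodMk_left
    have hm1 : AEMeasurable (fun z : Ω × Ω => ‖T z.1‖ₑ ^ 2 * κ z.1 z.2) (ν.prod ν) :=
      hTe.comp_fst.mul hκm.aemeasurable
    have hm2 : AEMeasurable (fun z : Ω × Ω => ‖T z.2‖ₑ ^ 2 * κ z.1 z.2) (ν.prod ν) :=
      hTe.comp_snd.mul hκm.aemeasurable
    rw [← enorm_integral_conj_mul_self hv2, h1]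
    calc _ ≤ ∫⁻ z : Ω × Ω, ‖(conj (T z.1) * T z.2) * ∫ x, a z.1 x * conj (a z.2 x) ∂μ‖ₑ
          ∂(ν.prod ν) := enorm_integral_le_lintegral_enorm _
      -- Schur's test with `x y ≤ x² + y²`; dropping the factor `1/2` is the origin of the `2` in `2
      -- * B`.
      _ ≤ ∫⁻ z : Ω × Ω, (‖T z.1‖ₑ ^ 2 * κ z.1 z.2 + ‖T z.2‖ₑ ^ 2 * κ z.1 z.2) ∂(ν.prod ν) := by
          refine lintegral_mono fun z => ?_
          simp only [enorm_mul, RCLike.enorm_conj]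
          rw [← add_mul]
          refine mul_le_mul' ?_ (hκ _ _)
          rcases le_total ‖T z.1‖ₑ ‖T z.2‖ₑ with h | h
          · exact (mul_le_mul_left h _).trans (by rw [← sq]; exact le_add_self)
          · exact (mul_le_mul_right h _).trans (by rw [← sq]; exact le_self_add)
      _ = ∫⁻ z : Ω × Ω, ‖T z.1‖ₑ ^ 2 * κ z.1 z.2 ∂(ν.prod ν) +
          ∫⁻ z : Ω × Ω, ‖T z.2‖ₑ ^ 2 * κ z.1 z.2 ∂(ν.prod ν) :=
          lintegral_add_left' hm1 _
      _ ≤ B * A + B * A := by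
          refine add_le_add ?_ ?_
          · rw [lintegral_prod _ hm1, mul_comm, hA,
              ← lintegral_mul_const'' _ hTe]
            refine lintegral_mono fun r => ?_
            simp only
            rw [lintegral_const_mul _ (hκr r)]
            exact mul_le_mul_right (hB r) _
          · rw [lintegral_prod_symm _ hm2, mul_comm, hA,
              ← lintegral_mul_const'' _ hTe]
            refine lintegral_mono fun r => ?_
            simp only
            simp_rw [hκs _ r]
            rw [lintegral_const_mul _ (hκr r)]
            exact mul_le_mul_right (hB r) _
      _ = 2 * B * A := by ring
  have hA2 : A ^ 2 ≤ (2 * B * ∫⁻ x, ‖F x‖ₑ ^ 2 ∂μ) * A := by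
    calc A ^ 2 = ‖∫ x, v x * F x ∂μ‖ₑ ^ 2 := by
          rw [← hvF, enorm_integral_conj_mul_self hT2]
      _ ≤ (∫⁻ x, ‖v x‖ₑ * ‖F x‖ₑ ∂μ) ^ 2 := by
          gcongr
          refine (enorm_integral_le_lintegral_enorm _).trans (le_of_eq ?_)
          simp_rw [enorm_mul]
      _ ≤ (∫⁻ x, ‖v x‖ₑ ^ 2 ∂μ) * ∫⁻ x, ‖F x‖ₑ ^ 2 ∂μ :=
          sq_lintegral_mul_le hvm.enorm hF.1.enorm
      _ ≤ (2 * B * A) * ∫⁻ x, ‖F x‖ₑ ^ 2 ∂μ := mul_le_mul_left hV _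
      _ = _ := by ring
  by_cases hA0 : A = 0
  · rw [hA0]
    exact zero_le
  · rw [sq] at hA2
    exact (ENNReal.mul_le_mul_iff_left hA0 hAtop).1 hA2

/-- A square function estimate from a bound for the kernel of `T T*`, where
`T F r = ∫ x, a r x * F x`. -/
theorem lintegral_enorm_integral_sq_le [SigmaFinite ν] [SFinite μ]
    {a : Ω → X → ℂ} (ha : Measurable (Function.uncurry a)) {w : X → ℝ} (hw : MemLp w 2 μ)
    (hb : ∀ r x, ‖a r x‖ ≤ w x) {κ : Ω → Ω → ℝ≥0∞} (hκm : Measurable (Function.uncurry κ))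
    (hκs : ∀ r r', κ r r' = κ r' r) (hκ : ∀ r r', ‖∫ x, a r x * conj (a r' x) ∂μ‖ₑ ≤ κ r r')
    {B : ℝ≥0∞} (hB : ∀ r, ∫⁻ r', κ r r' ∂ν ≤ B) {F : X → ℂ} (hF : MemLp F 2 μ) :
    ∫⁻ r, ‖∫ x, a r x * F x ∂μ‖ₑ ^ 2 ∂ν ≤ 2 * B * ∫⁻ x, ‖F x‖ₑ ^ 2 ∂μ := by
  -- The finite-measure bound does not involve the mass of `ν`, so it passes to an exhaustion.
  rw [← setLIntegral_univ, ← iUnion_spanningSets ν,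
    setLIntegral_iUnion_of_directed _ (monotone_spanningSets ν).directed_le]
  refine iSup_le fun n => ?_
  have : IsFiniteMeasure (ν.restrict (spanningSets ν n)) :=
    ⟨by simpa using measure_spanningSets_lt_top ν n⟩
  exact lintegral_enorm_integral_sq_le_of_isFiniteMeasure ha hw hb hκm hκs hκ
    (fun r => (setLIntegral_le_lintegral _ _).trans (hB r)) hF

end Duality

/-! ### Linearization of a countable supremum -/

section Selection

variable {α : Type*}

/-- The index of the largest among the first values of a sequence of functions. -/
noncomputable def argmaxIndex (f : ℕ → α → ℝ≥0∞) : ℕ → α → ℕ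
  | 0, _ => 0
  | n + 1, x => if f (argmaxIndex f n x) x ≤ f (n + 1) x then n + 1 else argmaxIndex f n x

theorem apply_argmaxIndex_succ (f : ℕ → α → ℝ≥0∞) (n : ℕ) (x : α) :
    f (argmaxIndex f (n + 1) x) x = max (f (argmaxIndex f n x) x) (f (n + 1) x) := by
  by_cases h : f (argmaxIndex f n x) x ≤ f (n + 1) x
  · simp [argmaxIndex, h]
  · simp [argmaxIndex, h, (not_le.1 h).le]

variable [MeasurableSpace α] {μ : Measure α}

theorem measurable_argmaxIndex {f : ℕ → α → ℝ≥0∞} (hf : ∀ i, Measurable (f i)) (n : ℕ) :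
    Measurable (argmaxIndex f n) ∧ Measurable fun x => f (argmaxIndex f n x) x := by
  have key : ∀ σ : α → ℕ, Measurable σ → Measurable fun x => f (σ x) x := fun σ hσ =>
    (measurable_from_prod_countable_right (f := fun p : ℕ × α => f p.1 p.2) hf).comp
      (hσ.prodMk measurable_id)
  suffices h : Measurable (argmaxIndex f n) from ⟨h, key _ h⟩
  induction n with
  | zero => exact measurable_const
  | succ n ih => exact Measurable.ite (measurableSet_le (key _ ih) (hf _)) measurable_const ih

/-- The integral of a countable supremum is controlled by the integrals along measurable choices
of the index. -/
theorem lintegral_iSup_le_of_selection {f : ℕ → α → ℝ≥0∞} (hf : ∀ i, Measurable (f i))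
    {B : ℝ≥0∞} (h : ∀ σ : α → ℕ, Measurable σ → ∫⁻ x, f (σ x) x ∂μ ≤ B) :
    ∫⁻ x, ⨆ i, f i x ∂μ ≤ B := by
  -- The selected values are the running maxima of the sequence: they increase to the supremum, so
  -- monotone convergence applies.
  have hmono : Monotone fun n x => f (argmaxIndex f n x) x :=
    monotone_nat_of_le_succ fun n x => by
      rw [apply_argmaxIndex_succ f]
      exact le_max_left _ _
  have hle : ∀ n x, f n x ≤ f (argmaxIndex f n x) x := fun n x => by
    cases n with
    | zero => exact le_rfl
    | succ n =>
      rw [apply_argmaxIndex_succ f]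
      exact le_max_right _ _
  calc ∫⁻ x, ⨆ i, f i x ∂μ ≤ ∫⁻ x, ⨆ n, f (argmaxIndex f n x) x ∂μ :=
        lintegral_mono fun x => iSup_mono fun n => hle n x
    _ = ⨆ n, ∫⁻ x, f (argmaxIndex f n x) x ∂μ :=
        lintegral_iSup (fun n => (measurable_argmaxIndex hf n).2) hmono
    _ ≤ B := iSup_le fun n => h _ (measurable_argmaxIndex hf n).1

open Filter Topology in
/-- Minkowski's inequality for countable sums in `L²`. -/
theorem eLpNorm_two_tsum_le {f : ℕ → α → ℝ≥0∞} (hf : ∀ i, Measurable (f i)) :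
    eLpNorm (fun x => ∑' i, f i x) 2 μ ≤ ∑' i, eLpNorm (f i) 2 μ := by
  have hsq : ∀ g : α → ℝ≥0∞, eLpNorm g 2 μ ^ 2 = ∫⁻ x, g x ^ 2 ∂μ := fun g => by
    simpa using eLpNorm_nnreal_pow_eq_lintegral (f := g) (p := 2) (μ := μ) two_ne_zero
  rw [← ENNReal.pow_le_pow_left_iff two_ne_zero, hsq]
  have hlim : Tendsto (fun n => ∫⁻ x, (∑ i ∈ Finset.range n, f i x) ^ 2 ∂μ) atTop
      (𝓝 (∫⁻ x, (∑' i, f i x) ^ 2 ∂μ)) := by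
    refine lintegral_tendsto_of_tendsto_of_monotone (fun n => ?_) (.of_forall fun x => ?_)
      (.of_forall fun x => ?_)
    · exact ((Finset.measurable_sum _ fun i _ => hf i).pow_const 2).aemeasurable
    · intro m n hmn
      exact pow_le_pow_left' (Finset.sum_le_sum_of_subset (Finset.range_mono hmn)) 2
    · exact ENNReal.Tendsto.pow (ENNReal.tendsto_nat_tsum _)
  refine le_of_tendsto' hlim fun n => ?_
  rw [← hsq]
  gcongr
  have h := eLpNorm_sum_le (p := 2) (μ := μ) (s := Finset.range n) (f := f)
    (fun i _ => (hf i).aestronglyMeasurable) one_le_two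
  have h' : (∑ i ∈ Finset.range n, f i) = fun x => ∑ i ∈ Finset.range n, f i x := by
    ext x
    simp
  rw [h'] at h
  exact h.trans (ENNReal.sum_le_tsum _)

end Selection

/-! ### The Gaussian-regularized kernel -/

/-- After completing the square, the modulus retains only `Re (-b + iT)⁻¹ = -b / (b² + T²)` in the
exponent. -/
theorem norm_integral_cexp_quadratic {b : ℝ} (hb : 0 < b) (T x : ℝ) :
    ‖∫ s : ℝ, Complex.exp ((-b + T * Complex.I) * s ^ 2 + (x * Complex.I) * s)‖ =
      (Real.pi / √(b ^ 2 + T ^ 2)) ^ (1 / 2 : ℝ) *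
        Real.exp (-(b * x ^ 2 / (4 * (b ^ 2 + T ^ 2)))) := by
  have h := integral_cexp_quadratic (b := -b + T * Complex.I) (by simpa using hb)
    (x * Complex.I) 0
  simp only [add_zero] at h
  have hpos : 0 < b ^ 2 + T ^ 2 := by positivity
  have hn : Complex.normSq (-b + T * Complex.I) = b ^ 2 + T ^ 2 := by
    simp [Complex.normSq_apply]
    ring
  have hne : (-b + T * Complex.I : ℂ) ≠ 0 := fun h0 => by
    rw [h0, map_zero] at hn
    exact hpos.ne hn
  rw [h, norm_mul, Complex.norm_exp]
  congr 1
  · have h2 : (1 / 2 : ℂ) = ((1 / 2 : ℝ) : ℂ) := by simp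
    rw [h2, Complex.norm_cpow_real, norm_div, norm_neg, Complex.norm_def (-b + T * Complex.I), hn,
      Complex.norm_real, Real.norm_of_nonneg Real.pi_pos.le]
  · congr 1
    have h3 : (0 - (x * Complex.I) ^ 2 / (4 * (-b + T * Complex.I)) : ℂ) =
        ((x ^ 2 / 4 : ℝ) : ℂ) * (-b + T * Complex.I)⁻¹ := by
      rw [mul_pow, Complex.I_sq]
      push_cast
      field_simp
      ring
    rw [h3, Complex.re_ofReal_mul, Complex.inv_re, hn]
    simp
    field_simp

namespace MaximalEstimate

noncomputable section

/-- A Gaussian in `ξ` cut off to `|P(τ, ξ)| ≤ δ`. -/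
def weight (b δ : ℝ) : SpaceTime → ℝ :=
  {y | |symb y| ≤ δ}.indicator fun y => Real.exp (-(b * ‖y.fst‖ ^ 2))

theorem measurable_weight (b δ : ℝ) : Measurable (weight b δ) := by
  refine Measurable.indicator (Continuous.measurable (by fun_prop)) ?_
  exact (isClosed_le continuous_symb.abs continuous_const).measurableSet

theorem weight_nonneg (b δ : ℝ) (y : SpaceTime) : 0 ≤ weight b δ y :=
  indicator_nonneg (fun _ _ => (Real.exp_pos _).le) _

theorem weight_mul_weight (b δ : ℝ) (y : SpaceTime) :
    weight b δ y * weight b δ y = weight (2 * b) δ y := by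
  unfold weight
  by_cases h : y ∈ {y : SpaceTime | |symb y| ≤ δ}
  · simp only [indicator_of_mem h, ← Real.exp_add]
    congr 1
    ring
  · simp [indicator_of_notMem h]

theorem weight_shear (b δ : ℝ) (p : ℝ × (ℝ × ℝ)) :
    weight b δ (shear p) = Real.exp (-b * p.1 ^ 2) *
      (Real.exp (-b * p.2.1 ^ 2) * (Icc (-δ) δ).indicator (fun _ => 1) p.2.2) := by
  unfold weight
  by_cases h : |p.2.2| ≤ δ
  · have h' : shear p ∈ {y : SpaceTime | |symb y| ≤ δ} := by simpa using h
    rw [indicator_of_mem h', indicator_of_mem (by exact abs_le.1 h), norm_sq_eq, shear_fst_zero,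
      shear_fst_one, mul_one, ← Real.exp_add]
    congr 1
    ring
  · have h' : shear p ∉ {y : SpaceTime | |symb y| ≤ δ} := by simpa using h
    rw [indicator_of_notMem h', indicator_of_notMem (show p.2.2 ∉ Icc (-δ) δ from
      fun h2 => h (abs_le.2 h2))]
    simp

theorem integrable_weight {b : ℝ} (hb : 0 < b) (δ : ℝ) : Integrable (weight b δ) := by
  rw [← measurePreserving_shear.integrable_comp_emb measurableEmbedding_shear]
  have h1 := integrable_exp_neg_mul_sq hb
  have h2 : Integrable ((Icc (-δ) δ).indicator (fun _ : ℝ => (1 : ℝ))) :=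
    (integrable_indicator_iff measurableSet_Icc).2 (integrableOn_const (by simp))
  refine (h1.mul_prod (h1.mul_prod h2)).congr (.of_forall fun p => ?_)
  exact (weight_shear b δ p).symm

theorem memLp_weight {b : ℝ} (hb : 0 < b) (δ : ℝ) : MemLp (weight b δ) 2 := by
  rw [memLp_two_iff_integrable_sq (measurable_weight b δ).aestronglyMeasurable]
  simp_rw [sq, weight_mul_weight]
  exact integrable_weight (by positivity) δ

/-- In the sheared coordinates the integral is a product: two one-dimensional Gaussians with
opposite signs of `T`, and an integral over `|μ| ≤ δ` bounded by `2 δ`. Only `T²` enters the moduli,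
so the indefinite signature of the symbol does no harm. -/
theorem norm_integral_cexp_weight_le {b δ : ℝ} (hb : 0 < b) (hδ : 0 ≤ δ) (y : SpaceTime) :
    ‖∫ ξ : SpaceTime, Complex.exp (Complex.I * (inner ℝ y ξ : ℝ)) * (weight b δ ξ : ℂ)‖ ≤
      2 * δ * (Real.pi / √(b ^ 2 + y.snd ^ 2) *
        Real.exp (-(b * ‖y.fst‖ ^ 2 / (4 * (b ^ 2 + y.snd ^ 2))))) := by
  rw [← measurePreserving_shear.integral_comp measurableEmbedding_shear]
  set T := y.snd with hT
  have hsplit : ∀ p : ℝ × (ℝ × ℝ),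
      Complex.exp (Complex.I * (inner ℝ y (shear p) : ℝ)) * (weight b δ (shear p) : ℂ) =
      Complex.exp ((-b + (-T : ℝ) * Complex.I) * p.1 ^ 2 + (y.fst 0 * Complex.I) * p.1) *
        (Complex.exp ((-b + T * Complex.I) * p.2.1 ^ 2 + (y.fst 1 * Complex.I) * p.2.1) *
          (Icc (-δ) δ).indicator (fun m : ℝ => Complex.exp (Complex.I * (T * m : ℝ))) p.2.2) := by
    intro p
    rw [weight_shear, inner_spaceTime, shear_fst_zero, shear_fst_one, shear_snd]
    by_cases h : p.2.2 ∈ Icc (-δ) δ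
    · rw [indicator_of_mem h, indicator_of_mem h, mul_one, Complex.ofReal_mul, Complex.ofReal_exp,
        Complex.ofReal_exp, ← Complex.exp_add, ← Complex.exp_add, ← Complex.exp_add,
        ← Complex.exp_add]
      congr 1
      push_cast
      ring
    · rw [indicator_of_notMem h, indicator_of_notMem h]
      simp
  simp_rw [hsplit]
  rw [Measure.volume_eq_prod, integral_prod_mul
    (fun s : ℝ => Complex.exp ((-b + (-T : ℝ) * Complex.I) * s ^ 2 + (y.fst 0 * Complex.I) * s))
    (fun q : ℝ × ℝ => Complex.exp ((-b + T * Complex.I) * q.1 ^ 2 + (y.fst 1 * Complex.I) * q.1) *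
          (Icc (-δ) δ).indicator (fun m : ℝ => Complex.exp (Complex.I * (T * m : ℝ))) q.2),
    Measure.volume_eq_prod, integral_prod_mul
    (fun s : ℝ => Complex.exp ((-b + T * Complex.I) * s ^ 2 + (y.fst 1 * Complex.I) * s))
    (fun m : ℝ => (Icc (-δ) δ).indicator (fun m : ℝ => Complex.exp (Complex.I * (T * m : ℝ))) m),
    norm_mul, norm_mul, norm_integral_cexp_quadratic hb, norm_integral_cexp_quadratic hb]
  have h3 : ‖∫ m : ℝ, (Icc (-δ) δ).indicator (fun m : ℝ => Complex.exp (Complex.I * (T * m : ℝ))) m‖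
      ≤ 2 * δ := by
    rw [integral_indicator measurableSet_Icc]
    refine (norm_setIntegral_le_of_norm_le_const (C := 1) (by simp) fun m _ => ?_).trans
      (le_of_eq ?_)
    · rw [mul_comm, Complex.norm_exp_ofReal_mul_I]
    · rw [Real.volume_real_Icc_of_le (by linarith)]
      ring
  have hc : 0 ≤ Real.pi / √(b ^ 2 + T ^ 2) := by positivity
  have h4 : (Real.pi / √(b ^ 2 + T ^ 2)) ^ (1 / 2 : ℝ) * (Real.pi / √(b ^ 2 + T ^ 2)) ^ (1 / 2 : ℝ) =
      Real.pi / √(b ^ 2 + T ^ 2) := by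
    rw [← Real.sqrt_eq_rpow, Real.mul_self_sqrt hc]
  have h5 : Real.exp (-(b * y.fst 0 ^ 2 / (4 * (b ^ 2 + T ^ 2)))) *
      Real.exp (-(b * y.fst 1 ^ 2 / (4 * (b ^ 2 + T ^ 2)))) =
      Real.exp (-(b * ‖y.fst‖ ^ 2 / (4 * (b ^ 2 + T ^ 2)))) := by
    rw [← Real.exp_add, norm_sq_eq]
    congr 1
    ring
  rw [neg_sq, ← h5]
  nth_rewrite 3 [← h4]
  have h6 := mul_le_mul_of_nonneg_left h3 (a := ((Real.pi / √(b ^ 2 + T ^ 2)) ^ (1 / 2 : ℝ) *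
    (Real.pi / √(b ^ 2 + T ^ 2)) ^ (1 / 2 : ℝ)) * (Real.exp (-(b * y.fst 0 ^ 2 / (4 * (b ^ 2 + T ^ 2)))) *
      Real.exp (-(b * y.fst 1 ^ 2 / (4 * (b ^ 2 + T ^ 2)))))) (by positivity)
  refine le_trans (le_of_eq ?_) (h6.trans (le_of_eq ?_)) <;> ring

/-! ### The dyadic majorant of the kernel -/

/-- Subtraction is truncated: the first `m` terms equal `1` and a geometric series follows. Used
with `m = 2 * k`, this is the source of both factors `k + 1`. -/
theorem tsum_pow_sub_le (x : ℝ≥0∞) (m : ℕ) : ∑' i : ℕ, x ^ (i - m) ≤ m + (1 - x)⁻¹ := by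
  rw [← Summable.sum_add_tsum_nat_add' (f := fun i : ℕ => x ^ (i - m)) (k := m) ENNReal.summable]
  refine add_le_add ?_ ?_
  · refine (Finset.sum_le_sum (g := fun _ => 1) fun i hi => ?_).trans (by simp)
    rw [Nat.sub_eq_zero_of_le (Finset.mem_range.1 hi).le, pow_zero]
  · simp [ENNReal.tsum_geometric]

/-- Both bounds come from `1 + u² ≤ exp (u²)`, the first with `2 u ≤ 1 + u²`. -/
theorem exp_neg_sq_le {u : ℝ} (hu : 0 < u) :
    Real.exp (-u ^ 2) ≤ 1 / (2 * u) ∧ Real.exp (-u ^ 2) ≤ 1 / u ^ 2 := by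
  have h := Real.add_one_le_exp (u ^ 2)
  rw [Real.exp_neg, ← one_div]
  constructor
  · exact one_div_le_one_div_of_le (by positivity) (by nlinarith [sq_nonneg (u - 1)])
  · exact one_div_le_one_div_of_le (by positivity) (by linarith)

/-- A dyadic majorant of the kernel `min (N², N / |r|, N² / r²)` with `N = 2 ^ k`. -/
def profile (k : ℕ) (r : ℝ) : ℝ≥0∞ :=
  ∑' i : ℕ, (Icc (-(2 ^ i / 2 ^ k) : ℝ) (2 ^ i / 2 ^ k)).indicator
    (fun _ => ENNReal.ofReal (400 * 4 ^ k * (1 / 2) ^ i * (1 / 2) ^ (i - 2 * k))) r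

theorem measurable_profile (k : ℕ) : Measurable (profile k) :=
  Measurable.tsum fun _ => measurable_const.indicator measurableSet_Icc

theorem profile_neg (k : ℕ) (r : ℝ) : profile k (-r) = profile k r := by
  unfold profile
  refine tsum_congr fun i => ?_
  have h : -r ∈ Icc (-(2 ^ i / 2 ^ k) : ℝ) (2 ^ i / 2 ^ k) ↔
      r ∈ Icc (-(2 ^ i / 2 ^ k) : ℝ) (2 ^ i / 2 ^ k) := by
    simp only [mem_Icc]
    constructor <;> rintro ⟨h1, h2⟩ <;> constructor <;> linarith
  by_cases h' : r ∈ Icc (-(2 ^ i / 2 ^ k) : ℝ) (2 ^ i / 2 ^ k)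
  · rw [indicator_of_mem h', indicator_of_mem (h.2 h')]
  · rw [indicator_of_notMem h', indicator_of_notMem (fun h2 => h' (h.1 h2))]

/-- Height times length of the `i`-th step is `800 * 2 ^ k` for every `i ≤ 2 * k`, and decays
geometrically beyond. -/
theorem lintegral_profile_le (k : ℕ) :
    ∫⁻ r, profile k r ≤ ENNReal.ofReal (1600 * 2 ^ k * (k + 1)) := by
  have hterm : ∀ i : ℕ, ∫⁻ r, (Icc (-(2 ^ i / 2 ^ k) : ℝ) (2 ^ i / 2 ^ k)).indicator
      (fun _ => ENNReal.ofReal (400 * 4 ^ k * (1 / 2) ^ i * (1 / 2) ^ (i - 2 * k))) r =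
      ENNReal.ofReal (800 * 2 ^ k) * (ENNReal.ofReal (1 / 2)) ^ (i - 2 * k) := by
    intro i
    rw [lintegral_indicator_const measurableSet_Icc, Real.volume_Icc,
      ← ENNReal.ofReal_mul (by positivity), ← ENNReal.ofReal_pow (by positivity),
      ← ENNReal.ofReal_mul (by positivity)]
    congr 1
    have h4 : (4 : ℝ) ^ k = 2 ^ k * 2 ^ k := by rw [← mul_pow]; norm_num
    have h1 : (1 / 2 : ℝ) ^ i * 2 ^ i = 1 := by rw [← mul_pow]; norm_num
    rw [h4]
    have h5 : (2 : ℝ) ^ k ≠ 0 := by positivity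
    generalize (1 / 2 : ℝ) ^ (i - 2 * k) = c
    generalize (1 / 2 : ℝ) ^ i = d at h1 ⊢
    field_simp
    linear_combination (800 * c) * h1
  unfold profile
  rw [lintegral_tsum fun i => (measurable_const.indicator measurableSet_Icc).aemeasurable]
  simp_rw [hterm]
  rw [ENNReal.tsum_mul_left]
  have h2 : (1 - ENNReal.ofReal (1 / 2))⁻¹ = ENNReal.ofReal 2 := by
    rw [← ENNReal.ofReal_one, ← ENNReal.ofReal_sub _ (by norm_num),
      ← ENNReal.ofReal_inv_of_pos (by norm_num)]
    norm_num
  calc _ ≤ ENNReal.ofReal (800 * 2 ^ k) * (((2 * k : ℕ) : ℝ≥0∞) + ENNReal.ofReal 2) := by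
        rw [← h2]
        gcongr
        exact tsum_pow_sub_le _ _
    _ = _ := by
        rw [← ENNReal.ofReal_natCast, ← ENNReal.ofReal_add (by positivity) (by norm_num),
          ← ENNReal.ofReal_mul (by positivity)]
        congr 1
        push_cast
        ring

/-- A single term of the majorant suffices, that of the least `i` with `|r| ≤ 2 ^ i / 2 ^ k`. With
`A = √(b² + T²)` and `b = N⁻²`, the kernel is `(π / A) exp (-u²)`, `u = ρ / (2 N A)`. The bound `A ≥
N⁻²` gives `N²`; `exp (-u²) ≤ 1 / (2 u)` gives `N / ρ`, with `A` cancelling; `exp (-u²) ≤ 1 / u²`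
gives `A N² / ρ²`, where the bound on `T` is needed to control `A`. -/
theorem gaussian_kernel_le_profile (k : ℕ) {r ρ T : ℝ} (hr : r ^ 2 ≤ ρ ^ 2) (hρ : 0 ≤ ρ)
    (hT : |T| ≤ 4) :
    ENNReal.ofReal (Real.pi / √((1 / 4 ^ k) ^ 2 + T ^ 2) *
      Real.exp (-((1 / 4 ^ k) * ρ ^ 2 / (4 * ((1 / 4 ^ k) ^ 2 + T ^ 2))))) ≤ profile k r := by
  have hex : ∃ i : ℕ, |r| ≤ 2 ^ i / 2 ^ k := by
    obtain ⟨i, hi⟩ := pow_unbounded_of_one_lt (|r| * 2 ^ k) (one_lt_two (α := ℝ))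
    exact ⟨i, (le_div_iff₀ (by positivity)).2 hi.le⟩
  classical
  obtain ⟨i, hi, hmin⟩ : ∃ i : ℕ, |r| ≤ 2 ^ i / 2 ^ k ∧ ∀ j < i, ¬ |r| ≤ 2 ^ j / 2 ^ k :=
    ⟨Nat.find hex, Nat.find_spec hex, fun j hj => Nat.find_min hex hj⟩
  refine le_trans ?_ (ENNReal.le_tsum i)
  rw [indicator_of_mem (show r ∈ Icc _ _ from abs_le.1 hi)]
  refine ENNReal.ofReal_le_ofReal ?_
  set N : ℝ := 2 ^ k with hN
  have hN1 : 1 ≤ N := one_le_pow₀ one_le_two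
  have h4 : (4 : ℝ) ^ k = N ^ 2 := by rw [hN, ← pow_mul, mul_comm, pow_mul]; norm_num
  rw [h4]
  set A : ℝ := √((1 / N ^ 2) ^ 2 + T ^ 2) with hA
  have hA2 : A ^ 2 = (1 / N ^ 2) ^ 2 + T ^ 2 := Real.sq_sqrt (by positivity)
  have hbA : 1 / N ^ 2 ≤ A := Real.le_sqrt_of_sq_le (by nlinarith [sq_nonneg T])
  have hb0 : 0 < 1 / N ^ 2 := by positivity
  have hA0 : 0 < A := hb0.trans_le hbA
  have hb1 : 1 / N ^ 2 ≤ 1 := by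
    rw [div_le_one (by positivity)]
    nlinarith
  have hA5 : A ≤ 5 := by
    refine Real.sqrt_le_iff.2 ⟨by norm_num, ?_⟩
    have := abs_le.1 hT
    nlinarith
  rw [← hA2]
  have hpi : Real.pi ≤ 4 := Real.pi_le_four
  have hpi0 := Real.pi_pos
  rcases Nat.eq_zero_or_pos i with rfl | hi0
  · have hexp : Real.exp (-((1 / N ^ 2) * ρ ^ 2 / (4 * A ^ 2))) ≤ 1 := by
      rw [Real.exp_le_one_iff]
      have : 0 ≤ (1 / N ^ 2) * ρ ^ 2 / (4 * A ^ 2) := by positivity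
      linarith
    simp only [pow_zero, mul_one, Nat.zero_sub]
    calc _ ≤ Real.pi / A * 1 := by gcongr
      _ ≤ Real.pi / (1 / N ^ 2) * 1 := by gcongr
      _ = Real.pi * N ^ 2 := by field_simp
      _ ≤ 400 * N ^ 2 := by gcongr; linarith
  · have hr1 : 2 ^ i / (2 * N) ≤ ρ := by
      -- Minimality of `i` gives the lower bound on `|r|`; this is why `i = 0` is treated apart.
      have h1 := (not_le.1 (hmin (i - 1) (by omega))).le
      have h2 : (2 : ℝ) ^ i = 2 * 2 ^ (i - 1) := by
        rw [← pow_succ']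
        congr 1
        omega
      have h3 : |r| ≤ ρ := abs_le_of_sq_le_sq hr hρ
      rw [h2, mul_div_mul_left _ _ two_ne_zero]
      exact h1.trans h3
    have hρ0 : 0 < ρ := lt_of_lt_of_le (by positivity) hr1
    set u : ℝ := ρ / (2 * N * A) with hu
    have hu0 : 0 < u := by positivity
    have hexp : -((1 / N ^ 2) * ρ ^ 2 / (4 * A ^ 2)) = -u ^ 2 := by
      rw [hu]
      field_simp
      norm_num
    rw [hexp]
    obtain ⟨hE1, hE2⟩ := exp_neg_sq_le hu0
    have h2i : (1 / 2 : ℝ) ^ i = 1 / 2 ^ i := by rw [one_div_pow]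
    rcases le_total i (2 * k) with hik | hik
    · rw [Nat.sub_eq_zero_of_le hik, pow_zero, mul_one, h2i]
      calc Real.pi / A * Real.exp (-u ^ 2) ≤ Real.pi / A * (1 / (2 * u)) := by gcongr
        _ = Real.pi * N / ρ := by rw [hu]; field_simp
        _ ≤ Real.pi * N / (2 ^ i / (2 * N)) := by gcongr
        _ = 2 * Real.pi * (N ^ 2 * (1 / 2 ^ i)) := by field_simp
        _ ≤ 400 * (N ^ 2 * (1 / 2 ^ i)) := by gcongr; linarith
        _ = _ := by ring
    · have h5 : (1 / 2 : ℝ) ^ (i - 2 * k) = N ^ 2 / 2 ^ i := by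
        rw [one_div_pow, hN, ← pow_mul, mul_comm k 2, eq_div_iff (by positivity), one_div,
          inv_mul_eq_iff_eq_mul₀ (by positivity), ← pow_add]
        congr 1
        omega
      rw [h5, h2i]
      calc Real.pi / A * Real.exp (-u ^ 2) ≤ Real.pi / A * (1 / u ^ 2) := by gcongr
        _ = 4 * Real.pi * A * N ^ 2 / ρ ^ 2 := by rw [hu]; field_simp; norm_num
        _ ≤ 4 * Real.pi * A * N ^ 2 / (2 ^ i / (2 * N)) ^ 2 := by gcongr
        _ = 16 * Real.pi * A * (N ^ 2 * (1 / 2 ^ i) * (N ^ 2 / 2 ^ i)) := by field_simp; norm_num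
        _ ≤ 400 * (N ^ 2 * (1 / 2 ^ i) * (N ^ 2 / 2 ^ i)) := by
            gcongr
            nlinarith [Real.pi_lt_d2]
        _ = _ := by ring

/-! ### The maximal function of a piece of bounded modulation -/

/-- The integral `∫ e^{i ⟨y, ξ⟩} g(ξ) dξ` over space-time frequencies. -/
def osc (g : SpaceTime → ℂ) (y : SpaceTime) : ℂ :=
  ∫ ξ : SpaceTime, Complex.exp (Complex.I * (inner ℝ y ξ : ℝ)) * g ξ

theorem norm_cexp_inner (y ξ : SpaceTime) : ‖Complex.exp (Complex.I * (inner ℝ y ξ : ℝ))‖ = 1 := by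
  rw [mul_comm, Complex.norm_exp_ofReal_mul_I]

theorem continuous_osc {g : SpaceTime → ℂ} (hg : Integrable g) : Continuous (osc g) := by
  refine continuous_of_dominated (bound := fun ξ => ‖g ξ‖) (fun y => ?_)
    (fun y => .of_forall fun ξ => ?_) hg.norm (.of_forall fun ξ => ?_)
  · exact (Continuous.aestronglyMeasurable (by fun_prop)).mul hg.1
  · rw [norm_mul, norm_cexp_inner, one_mul]
  · fun_prop

theorem lintegral_enorm_le_box {R δ : ℝ} (hR : 0 ≤ R) {g : SpaceTime → ℂ}
    (hg : AEStronglyMeasurable g volume) (h0 : ∀ᵐ ξ, ξ ∉ box R δ → g ξ = 0) :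
    ∫⁻ ξ, ‖g ξ‖ₑ ≤ ENNReal.ofReal (8 * R ^ 2 * δ) ^ (1 / 2 : ℝ) * eLpNorm g 2 volume := by
  have h1 : ∫⁻ ξ, ‖g ξ‖ₑ = ∫⁻ ξ, (box R δ).indicator (fun _ => 1) ξ * ‖g ξ‖ₑ := by
    refine lintegral_congr_ae ?_
    filter_upwards [h0] with ξ hξ
    by_cases h : ξ ∈ box R δ
    · simp [h]
    · simp [h, hξ h]
  have h2 := sq_lintegral_mul_le (μ := volume)
    (measurable_const.indicator (f := fun _ => (1 : ℝ≥0∞)) (measurableSet_box R δ)).aemeasurable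
    hg.enorm
  have h3 : ∫⁻ ξ, (box R δ).indicator (fun _ => (1 : ℝ≥0∞)) ξ ^ 2 = volume (box R δ) := by
    have : ∀ ξ, (box R δ).indicator (fun _ => (1 : ℝ≥0∞)) ξ ^ 2 =
        (box R δ).indicator (fun _ => 1) ξ := fun ξ => by
      by_cases h : ξ ∈ box R δ <;> simp [h]
    simp_rw [this]
    rw [lintegral_indicator_const (measurableSet_box R δ), one_mul]
  rw [h3, ← h1, ← eLpNorm_two_sq] at h2
  rw [← ENNReal.pow_le_pow_left_iff two_ne_zero]
  refine h2.trans ?_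
  rw [mul_pow, ← ENNReal.rpow_two (_ ^ (1 / 2 : ℝ)), ← ENNReal.rpow_mul]
  norm_num
  gcongr
  exact volume_box_le hR

theorem integrable_of_box {R δ : ℝ} (hR : 0 ≤ R) {g : SpaceTime → ℂ} (hg : MemLp g 2 volume)
    (h0 : ∀ᵐ ξ, ξ ∉ box R δ → g ξ = 0) : Integrable g := by
  refine ⟨hg.1, (lintegral_enorm_le_box hR hg.1 h0).trans_lt ?_⟩
  exact ENNReal.mul_lt_top (ENNReal.rpow_lt_top_of_nonneg (by norm_num) ENNReal.ofReal_ne_top) hg.2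

variable {e : Plane}

/-- The Gaussian weight is inserted into the operator and its inverse into the function, which costs
only a constant on the support of `g`. Two weights with parameter `b / 2` multiply in `T T*` to one
with parameter `b = 4^{-k}`. The kernel bound depends on `r - r'` alone, whatever the selection `z`.
-/
theorem lintegral_osc_selection_le (he : ‖e‖ = 1) (k : ℕ) {δ : ℝ} (hδ : 0 ≤ δ) {g : SpaceTime → ℂ}
    (hg : MemLp g 2 volume) (h0 : ∀ᵐ ξ, ξ ∉ box (2 * 2 ^ k) δ → g ξ = 0)
    {z : ℝ → ℝ × ℝ} (hz : Measurable z) (hz2 : ∀ r, |(z r).2| ≤ 2) :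
    ∫⁻ r, ‖osc g (coord e (r, z r))‖ₑ ^ 2 ≤
      ENNReal.ofReal (409600 * δ * 2 ^ k * (k + 1)) * eLpNorm g 2 volume ^ 2 := by
  set b : ℝ := 1 / 4 ^ k with hb
  have hb0 : 0 < b := by positivity
  set a : ℝ → SpaceTime → ℂ := fun r ξ =>
    Complex.exp (Complex.I * (inner ℝ (coord e (r, z r)) ξ : ℝ)) * (weight (b / 2) δ ξ : ℂ) with ha
  set F : SpaceTime → ℂ := fun ξ => (Real.exp (b / 2 * ‖ξ.fst‖ ^ 2) : ℂ) * g ξ with hF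
  set κ : ℝ → ℝ → ℝ≥0∞ := fun r r' => ENNReal.ofReal (2 * δ) * profile k (r - r') with hκ
  have haF : ∀ r, osc g (coord e (r, z r)) = ∫ ξ, a r ξ * F ξ := fun r => by
    refine integral_congr_ae ?_
    filter_upwards [h0] with ξ hξ
    by_cases h : ξ ∈ box (2 * 2 ^ k) δ
    · have h1 : weight (b / 2) δ ξ = Real.exp (-(b / 2 * ‖ξ.fst‖ ^ 2)) :=
        indicator_of_mem (show ξ ∈ {y : SpaceTime | |symb y| ≤ δ} from h.2) _
      simp only [ha, hF, h1]
      rw [mul_assoc, ← mul_assoc (Complex.ofReal _), ← Complex.ofReal_mul, ← Real.exp_add,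
        neg_add_cancel, Real.exp_zero]
      simp
    · simp [hF, hξ h]
  have hFg : ∀ᵐ ξ, ‖F ξ‖ ≤ 8 * ‖g ξ‖ := by
    filter_upwards [h0] with ξ hξ
    by_cases h : ξ ∈ box (2 * 2 ^ k) δ
    · rw [hF, norm_mul, Complex.norm_real, Real.norm_of_nonneg (Real.exp_pos _).le]
      gcongr
      -- The choice `b = 4^{-k}` keeps the exponent bounded for `|ξ| ≤ 2 * 2 ^ k`, and `exp 2 ≤ 8`.
      have h1 : b / 2 * ‖ξ.fst‖ ^ 2 ≤ 2 := by
        have h2 : ‖ξ.fst‖ ^ 2 ≤ (2 * 2 ^ k) ^ 2 := pow_le_pow_left₀ (norm_nonneg _) h.1 2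
        have h3 : (2 * 2 ^ k : ℝ) ^ 2 = 4 * 4 ^ k := by
          rw [mul_pow, ← pow_mul, mul_comm k, pow_mul]
          norm_num
        calc b / 2 * ‖ξ.fst‖ ^ 2 ≤ b / 2 * (4 * 4 ^ k) := by rw [← h3]; gcongr
          _ = 2 := by rw [hb]; field_simp; norm_num
      refine (Real.exp_le_exp.2 h1).trans ?_
      have h4 : Real.exp 2 = Real.exp 1 * Real.exp 1 := by rw [← Real.exp_add]; norm_num
      nlinarith [Real.exp_one_lt_d9, Real.exp_pos 1]
    · simp [hF, hξ h]
  have hFm : MemLp F 2 volume :=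
    MemLp.of_le_mul hg ((Continuous.aestronglyMeasurable (by fun_prop)).mul hg.1) hFg
  have ham : Measurable (Function.uncurry a) := by
    have h1 : Measurable fun p : ℝ × SpaceTime => coord e (p.1, z p.1) :=
      (continuous_coord e).measurable.comp (measurable_fst.prodMk (hz.comp measurable_fst))
    have h2 : Measurable fun p : ℝ × SpaceTime => (inner ℝ (coord e (p.1, z p.1)) p.2 : ℝ) :=
      h1.inner measurable_snd
    exact (Complex.measurable_exp.comp ((Complex.measurable_ofReal.comp h2).const_mul _)).mul
      (Complex.measurable_ofReal.comp ((measurable_weight _ _).comp measurable_snd))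
  -- The value of `B` is `2 δ` times the bound for the integral of `profile k`; the final constant
  -- is `2 * 3200 * 8²`.
  have key := lintegral_enorm_integral_sq_le (ν := volume) (μ := volume) (a := a) ham
    (memLp_weight (half_pos hb0) δ) (fun r ξ => ?_) (κ := κ) ?_ ?_ ?_
    (B := ENNReal.ofReal (3200 * δ * 2 ^ k * (k + 1))) ?_ hFm
  · simp_rw [haF]
    refine key.trans ?_
    have hF2 : ∫⁻ ξ, ‖F ξ‖ₑ ^ 2 ≤ 64 * eLpNorm g 2 volume ^ 2 := by
      rw [← eLpNorm_two_sq]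
      have h1 := eLpNorm_le_mul_eLpNorm_of_ae_le_mul hFg 2
      calc eLpNorm F 2 volume ^ 2 ≤ (ENNReal.ofReal 8 * eLpNorm g 2 volume) ^ 2 := by gcongr
        _ = 64 * eLpNorm g 2 volume ^ 2 := by
            rw [mul_pow, ← ENNReal.ofReal_pow (by norm_num)]
            norm_num
    calc _ ≤ 2 * ENNReal.ofReal (3200 * δ * 2 ^ k * (k + 1)) * (64 * eLpNorm g 2 volume ^ 2) := by
          gcongr
      _ = ENNReal.ofReal 128 * ENNReal.ofReal (3200 * δ * 2 ^ k * (k + 1)) *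
            eLpNorm g 2 volume ^ 2 := by
          have : ENNReal.ofReal 128 = 2 * 64 := by norm_num
          rw [this]
          ring
      _ = _ := by
          rw [← ENNReal.ofReal_mul (by norm_num)]
          congr 2
          ring
  · rw [ha, norm_mul, norm_cexp_inner, one_mul, Complex.norm_real,
      Real.norm_of_nonneg (weight_nonneg _ _ _)]
  · exact ((measurable_profile k).comp (measurable_fst.sub measurable_snd)).const_mul _
  · intro r r'
    simp only [hκ]
    rw [← profile_neg, neg_sub]
  · intro r r'
    set y := coord e ((r, z r) - (r', z r')) with hy
    have h1 : ∀ ξ, a r ξ * (starRingEnd ℂ) (a r' ξ) =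
        Complex.exp (Complex.I * (inner ℝ y ξ : ℝ)) * (weight b δ ξ : ℂ) := fun ξ => by
      have h2 : weight b δ ξ = weight (b / 2) δ ξ * weight (b / 2) δ ξ := by
        rw [weight_mul_weight, mul_div_cancel₀ _ (two_ne_zero' ℝ)]
      simp only [ha, map_mul, Complex.conj_ofReal, ← Complex.exp_conj, Complex.conj_I]
      rw [hy, coord_sub, inner_sub_left, h2, mul_mul_mul_comm, ← Complex.exp_add,
        ← Complex.ofReal_mul]
      congr 2
      push_cast
      ring
    simp_rw [h1]
    have hT : |y.snd| ≤ 4 := by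
      have h3 := abs_sub (z r).2 (z r').2
      have h4 := hz2 r
      have h5 := hz2 r'
      calc |y.snd| = |(z r).2 - (z r').2| := rfl
        _ ≤ 4 := by linarith
    have hr : (r - r') ^ 2 ≤ ‖y.fst‖ ^ 2 := by
      rw [hy, norm_sq_coord_fst he]
      simp only [Prod.fst_sub]
      nlinarith [sq_nonneg ((r, z r) - (r', z r')).2.1]
    rw [← ofReal_norm]
    refine (ENNReal.ofReal_le_ofReal (norm_integral_cexp_weight_le hb0 hδ y)).trans ?_
    rw [ENNReal.ofReal_mul (by positivity)]
    exact mul_le_mul_right (gaussian_kernel_le_profile k hr (norm_nonneg _) hT) _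
  · intro r
    have hm : Measurable fun r' : ℝ => profile k (r - r') :=
      (measurable_profile k).comp (measurable_const.sub measurable_id)
    simp only [hκ]
    rw [lintegral_const_mul _ hm,
      lintegral_sub_left_eq_self (fun r' => profile k r') r]
    refine (mul_le_mul_right (lintegral_profile_le k) _).trans (le_of_eq ?_)
    rw [← ENNReal.ofReal_mul (by positivity)]
    congr 1
    ring

instance : Nonempty (Icc (-2 : ℝ) 2) := ⟨⟨0, by norm_num, by norm_num⟩⟩

/-- A dense sequence in `ℝ × [-2, 2]`. -/
def densePoint (i : ℕ) : ℝ × Icc (-2 : ℝ) 2 := TopologicalSpace.denseSeq (ℝ × Icc (-2 : ℝ) 2) i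

/-- The maximal function `sup ‖osc g (r e + v e^⊥, t)‖` over `v` and `|t| ≤ 2`. -/
def maximalFn (e : Plane) (g : SpaceTime → ℂ) (r : ℝ) : ℝ≥0∞ :=
  (⨆ i, ‖osc g (coord e (r, ((densePoint i).1, ((densePoint i).2 : ℝ))))‖ₑ ^ 2) ^ (1 / 2 : ℝ)

theorem measurable_enorm_osc_densePoint {g : SpaceTime → ℂ} (hg : Integrable g) (i : ℕ) :
    Measurable fun r : ℝ =>
      ‖osc g (coord e (r, ((densePoint i).1, ((densePoint i).2 : ℝ))))‖ₑ ^ 2 := by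
  refine Measurable.pow_const (Measurable.enorm ?_) 2
  exact ((continuous_osc hg).comp ((continuous_coord e).comp
    (continuous_id.prodMk continuous_const))).measurable

theorem measurable_maximalFn {g : SpaceTime → ℂ} (hg : Integrable g) :
    Measurable (maximalFn e g) :=
  (Measurable.iSup fun i => measurable_enorm_osc_densePoint hg i).pow_const _

/-- Integrability of `g` makes `osc g` continuous, so the supremum over a dense sequence already
dominates every point. -/
theorem enorm_osc_le_maximalFn {g : SpaceTime → ℂ} (hg : Integrable g) (r v : ℝ) {t : ℝ}
    (ht : t ∈ Icc (-2 : ℝ) 2) : ‖osc g (coord e (r, (v, t)))‖ₑ ≤ maximalFn e g r := by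
  have hcont : Continuous fun p : ℝ × Icc (-2 : ℝ) 2 =>
      ‖osc g (coord e (r, (p.1, (p.2 : ℝ))))‖ₑ ^ 2 := by
    refine (ENNReal.continuous_pow 2).comp (continuous_enorm.comp ((continuous_osc hg).comp
      ((continuous_coord e).comp ?_)))
    fun_prop
  have h : ∀ p : ℝ × Icc (-2 : ℝ) 2, ‖osc g (coord e (r, (p.1, (p.2 : ℝ))))‖ₑ ^ 2 ≤
      ⨆ i, ‖osc g (coord e (r, ((densePoint i).1, ((densePoint i).2 : ℝ))))‖ₑ ^ 2 := fun p => by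
    refine (TopologicalSpace.denseRange_denseSeq (ℝ × Icc (-2 : ℝ) 2)).induction_on
      (p := fun p => ‖osc g (coord e (r, (p.1, (p.2 : ℝ))))‖ₑ ^ 2 ≤ _) p
      (isClosed_le hcont continuous_const) fun i => ?_
    exact le_iSup (fun i =>
      ‖osc g (coord e (r, ((densePoint i).1, ((densePoint i).2 : ℝ))))‖ₑ ^ 2) i
  calc ‖osc g (coord e (r, (v, t)))‖ₑ
      = (‖osc g (coord e (r, (v, t)))‖ₑ ^ 2) ^ (1 / 2 : ℝ) := by
        rw [← ENNReal.rpow_two, ← ENNReal.rpow_mul]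
        norm_num
    _ ≤ _ := ENNReal.rpow_le_rpow (h (v, ⟨t, ht⟩)) (by norm_num)

theorem eLpNorm_maximalFn_le (he : ‖e‖ = 1) (k : ℕ) {δ : ℝ} (hδ : 0 ≤ δ) {g : SpaceTime → ℂ}
    (hg : MemLp g 2 volume) (h0 : ∀ᵐ ξ, ξ ∉ box (2 * 2 ^ k) δ → g ξ = 0) :
    eLpNorm (maximalFn e g) 2 volume ≤
      ENNReal.ofReal (409600 * δ * 2 ^ k * (k + 1)) ^ (1 / 2 : ℝ) * eLpNorm g 2 volume := by
  have hgi := integrable_of_box (by positivity) hg h0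
  rw [← ENNReal.pow_le_pow_left_iff two_ne_zero, mul_pow, ← ENNReal.rpow_two (_ ^ (1 / 2 : ℝ)),
    ← ENNReal.rpow_mul]
  have h1 : eLpNorm (maximalFn e g) 2 volume ^ 2 = ∫⁻ r, ⨆ i,
      ‖osc g (coord e (r, ((densePoint i).1, ((densePoint i).2 : ℝ))))‖ₑ ^ 2 := by
    have h := eLpNorm_nnreal_pow_eq_lintegral (f := maximalFn e g) (p := 2) (μ := volume)
      two_ne_zero
    simp only [ENNReal.coe_ofNat, NNReal.coe_ofNat, ENNReal.rpow_two, enorm_eq_self] at h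
    rw [h]
    refine lintegral_congr fun r => ?_
    rw [maximalFn, ← ENNReal.rpow_two, ← ENNReal.rpow_mul]
    norm_num
  rw [h1]
  norm_num
  refine lintegral_iSup_le_of_selection (fun i => measurable_enorm_osc_densePoint hgi i)
    fun σ hσ => ?_
  refine lintegral_osc_selection_le he k hδ hg h0
    (z := fun r => ((densePoint (σ r)).1, ((densePoint (σ r)).2 : ℝ))) ?_ fun r => ?_
  · exact (measurable_from_nat (f := fun i => ((densePoint i).1, ((densePoint i).2 : ℝ)))).comp hσ
  · exact abs_le.2 (densePoint (σ r)).2.2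

/-! ### Dyadic decomposition in the modulation -/

theorem norm_fst_le_of_mem_regionDTop {k : ℕ} {y : SpaceTime} (hy : y ∈ regionDTop k) :
    ‖y.fst‖ ≤ 2 * 2 ^ k := by
  obtain ⟨j, hj⟩ := mem_iUnion.1 hy
  have h := hj.1
  split_ifs at h with hk
  · subst hk
    simpa using h
  · rw [← pow_succ']
    exact h.2

theorem le_norm_fst_of_mem_regionDTop {k : ℕ} (hk : k ≠ 0) {y : SpaceTime}
    (hy : y ∈ regionDTop k) : 2 ^ k / 2 ≤ ‖y.fst‖ := by
  obtain ⟨j, hj⟩ := mem_iUnion.1 hy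
  have h := hj.1
  rw [if_neg hk] at h
  obtain ⟨m, rfl⟩ := Nat.exists_eq_succ_of_ne_zero hk
  refine le_trans (le_of_eq ?_) h.1
  simp [pow_succ]

theorem continuous_dyadic {η : ℝ → ℝ} (hη : IsCutoff η) (j : ℕ) : Continuous (dyadic η j) := by
  have h := hη.smooth.continuous
  cases j with
  | zero => exact h
  | succ j =>
    unfold dyadic
    fun_prop

theorem abs_dyadic_le_one {η : ℝ → ℝ} (hη : IsCutoff η) (j : ℕ) (s : ℝ) : |dyadic η j s| ≤ 1 := by
  cases j with
  | zero =>
    have h := hη.range s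
    exact abs_le.2 ⟨by simp only [dyadic]; linarith [h.1], h.2⟩
  | succ j =>
    have h1 := hη.range (s / 2 ^ (j + 1))
    have h2 := hη.range (s / 2 ^ j)
    exact abs_le.2 ⟨by simp only [dyadic]; linarith [h1.1, h2.2],
      by simp only [dyadic]; linarith [h1.2, h2.1]⟩

theorem abs_le_of_dyadic_ne_zero {η : ℝ → ℝ} (hη : IsCutoff η) {j : ℕ} {s : ℝ}
    (h : dyadic η j s ≠ 0) : |s| ≤ 2 * 2 ^ j := by
  have hsupp : ∀ u : ℝ, η u ≠ 0 → |u| ≤ 2 := fun u hu => hη.supp hu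
  cases j with
  | zero => simpa using hsupp s h
  | succ j =>
    by_contra hs
    have hs' := not_le.1 hs
    have hp : (0 : ℝ) < 2 ^ j := by positivity
    have h1 : η (s / 2 ^ (j + 1)) = 0 := by
      by_contra h1
      have := hsupp _ h1
      rw [abs_div, abs_of_pos (by positivity : (0 : ℝ) < 2 ^ (j + 1)),
        div_le_iff₀ (by positivity)] at this
      exact hs this
    have h2 : η (s / 2 ^ j) = 0 := by
      by_contra h2
      have := hsupp _ h2
      rw [abs_div, abs_of_pos hp, div_le_iff₀ hp] at this
      rw [pow_succ] at hs'
      linarith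
    exact h (by simp [dyadic, h1, h2])

/-- For `|s|` small relative to `2 ^ j` both cut-offs in the difference equal `1` and cancel. The
`max` with `1` accommodates `j = 0`, where nothing cancels. -/
theorem two_pow_le_of_dyadic_ne_zero {η : ℝ → ℝ} (hη : IsCutoff η) {j : ℕ} {s : ℝ}
    (h : dyadic η j s ≠ 0) : (2 : ℝ) ^ j ≤ 4 * max 1 |s| := by
  cases j with
  | zero =>
    have := le_max_left 1 |s|
    rw [pow_zero]
    linarith
  | succ j =>
    by_contra hs
    have hs' := not_le.1 hs
    have h0 := le_max_right 1 |s|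
    have hp : (0 : ℝ) < 2 ^ j := by positivity
    have hlt : 2 * |s| < 2 ^ j := by
      rw [pow_succ] at hs'
      linarith
    have h2 : η (s / 2 ^ j) = 1 := by
      refine hη.one _ ?_
      rw [abs_div, abs_of_pos hp, div_le_iff₀ hp]
      linarith
    have h1 : η (s / 2 ^ (j + 1)) = 1 := by
      refine hη.one _ ?_
      rw [abs_div, abs_of_pos (by positivity : (0 : ℝ) < 2 ^ (j + 1)),
        div_le_iff₀ (by positivity), pow_succ]
      linarith [abs_nonneg s]
    exact h (by simp [dyadic, h1, h2])

theorem sum_dyadic (η : ℝ → ℝ) (s : ℝ) (n : ℕ) :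
    ∑ j ∈ Finset.range (n + 1), dyadic η j s = η (s / 2 ^ n) := by
  induction n with
  | zero => simp [dyadic]
  | succ n ih =>
    rw [Finset.sum_range_succ, ih]
    simp [dyadic]

theorem hasSum_dyadic {η : ℝ → ℝ} (hη : IsCutoff η) (s : ℝ) :
    HasSum (fun j => dyadic η j s) 1 := by
  obtain ⟨n, hn⟩ := pow_unbounded_of_one_lt (4 * max 1 |s|) (one_lt_two (α := ℝ))
  have h1 : η (s / 2 ^ n) = 1 := by
    refine hη.one _ ?_
    have := le_max_right 1 |s|
    rw [abs_div, abs_of_pos (by positivity : (0 : ℝ) < 2 ^ n), div_le_iff₀ (by positivity)]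
    linarith [abs_nonneg s]
  rw [← h1, ← sum_dyadic η]
  refine hasSum_sum_of_ne_finset_zero fun j hj => ?_
  by_contra h
  have h2 := two_pow_le_of_dyadic_ne_zero hη h
  have h3 : (2 : ℝ) ^ n ≤ 2 ^ j :=
    pow_le_pow_right₀ one_le_two (by simp only [Finset.mem_range, not_lt] at hj; omega)
  linarith

/-- The dyadic piece `η_j(P) f`. -/
def piece (η : ℝ → ℝ) (f : SpaceTime → ℂ) (j : ℕ) (y : SpaceTime) : ℂ :=
  (dyadic η j (symb y) : ℂ) * f y

theorem normX_eq (η : ℝ → ℝ) (f : L2) : normX η f =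
    ∑' j : ℕ, (2 : ℝ≥0∞) ^ ((j : ℝ) / 2) * eLpNorm (piece η f j) 2 volume := rfl

theorem hasSum_piece {η : ℝ → ℝ} (hη : IsCutoff η) (f : SpaceTime → ℂ) (y : SpaceTime) :
    HasSum (fun j => piece η f j y) (f y) := by
  simpa [piece] using
    ((Complex.hasSum_ofReal).2 (hasSum_dyadic hη (symb y))).mul_right (f y)

theorem aestronglyMeasurable_piece {η : ℝ → ℝ} (hη : IsCutoff η) {f : SpaceTime → ℂ}
    (hf : AEStronglyMeasurable f volume) (j : ℕ) : AEStronglyMeasurable (piece η f j) volume :=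
  (Complex.continuous_ofReal.comp
    ((continuous_dyadic hη j).comp continuous_symb)).aestronglyMeasurable.mul hf

theorem memLp_piece {η : ℝ → ℝ} (hη : IsCutoff η) {f : SpaceTime → ℂ} (hf : MemLp f 2 volume)
    (j : ℕ) : MemLp (piece η f j) 2 volume := by
  refine hf.of_le (aestronglyMeasurable_piece hη hf.1 j) (.of_forall fun y => ?_)
  rw [piece, norm_mul, Complex.norm_real]
  exact mul_le_of_le_one_left (norm_nonneg _) (abs_dyadic_le_one hη j _)

theorem piece_eq_zero_of_notMem_box {η : ℝ → ℝ} (hη : IsCutoff η) {f : SpaceTime → ℂ} {k : ℕ}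
    (h0 : ∀ᵐ y, y ∉ regionDTop k → f y = 0) (j : ℕ) :
    ∀ᵐ y, y ∉ box (2 * 2 ^ k) (2 * 2 ^ j) → piece η f j y = 0 := by
  filter_upwards [h0] with y hy hbox
  by_cases h1 : y ∈ regionDTop k
  · by_cases h2 : dyadic η j (symb y) = 0
    · simp [piece, h2]
    · exact absurd ⟨norm_fst_le_of_mem_regionDTop h1, abs_le_of_dyadic_ne_zero hη h2⟩ hbox
  · simp [piece, hy h1]

theorem ofReal_two_pow_rpow_half (n : ℕ) :
    ENNReal.ofReal (2 ^ n) ^ (1 / 2 : ℝ) = (2 : ℝ≥0∞) ^ ((n : ℝ) / 2) := by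
  rw [ENNReal.ofReal_pow (by norm_num), ENNReal.ofReal_ofNat, ← ENNReal.rpow_natCast,
    ← ENNReal.rpow_mul]
  congr 1
  ring

/-- Cauchy-Schwarz on a box of volume of order `4^k 2^j` costs `2^{j/2}`, precisely the weight in
the `X_k` norm. Hence members of `X_k` are integrable and their transforms are given by honest
integrals. -/
theorem tsum_lintegral_piece_lt_top {η : ℝ → ℝ} (hη : IsCutoff η) {f : L2} {k : ℕ}
    (h0 : ∀ᵐ y, y ∉ regionDTop k → f y = 0) (hf : normX η f < ∞) :
    ∑' j, ∫⁻ y, ‖piece η f j y‖ₑ < ∞ := by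
  have hle : ∀ j, ∫⁻ y, ‖piece η f j y‖ₑ ≤ ENNReal.ofReal (16 * (2 * 2 ^ k) ^ 2) ^ (1 / 2 : ℝ) *
      ((2 : ℝ≥0∞) ^ ((j : ℝ) / 2) * eLpNorm (piece η f j) 2 volume) := fun j => by
    refine (lintegral_enorm_le_box (by positivity)
      (aestronglyMeasurable_piece hη (Lp.aestronglyMeasurable f) j)
      (piece_eq_zero_of_notMem_box hη h0 j)).trans (le_of_eq ?_)
    rw [← mul_assoc (_ ^ (1 / 2 : ℝ)), ← ofReal_two_pow_rpow_half, ← ENNReal.mul_rpow_of_nonneg _ _ (by norm_num),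
      ← ENNReal.ofReal_mul (by positivity)]
    congr 3
    ring
  refine (ENNReal.tsum_le_tsum hle).trans_lt ?_
  rw [ENNReal.tsum_mul_left, ← normX_eq]
  exact ENNReal.mul_lt_top (ENNReal.rpow_lt_top_of_nonneg (by norm_num) ENNReal.ofReal_ne_top) hf

theorem integrable_of_normX_lt_top {η : ℝ → ℝ} (hη : IsCutoff η) {f : L2} {k : ℕ}
    (h0 : ∀ᵐ y, y ∉ regionDTop k → f y = 0) (hf : normX η f < ∞) : Integrable f := by
  refine ⟨Lp.aestronglyMeasurable f, ?_⟩
  refine lt_of_le_of_lt ?_ (tsum_lintegral_piece_lt_top hη h0 hf)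
  rw [← lintegral_tsum fun j =>
    (aestronglyMeasurable_piece hη (Lp.aestronglyMeasurable f) j).enorm]
  refine lintegral_mono fun y => ?_
  rw [← (hasSum_piece hη f y).tsum_eq]
  exact enorm_tsum_le_tsum_enorm

theorem enorm_osc_le_tsum {η : ℝ → ℝ} (hη : IsCutoff η) {f : L2} {k : ℕ}
    (h0 : ∀ᵐ y, y ∉ regionDTop k → f y = 0) (hf : normX η f < ∞) (y : SpaceTime) :
    ‖osc f y‖ₑ ≤ ∑' j, ‖osc (piece η f j) y‖ₑ := by
  have h1 : osc f y = ∑' j, osc (piece η f j) y := by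
    unfold osc
    rw [← integral_tsum]
    · refine integral_congr_ae (.of_forall fun ξ => ?_)
      simp only
      rw [tsum_mul_left, (hasSum_piece hη f ξ).tsum_eq]
    · intro j
      exact (Continuous.aestronglyMeasurable (by fun_prop)).mul
        (aestronglyMeasurable_piece hη (Lp.aestronglyMeasurable f) j)
    · refine ne_of_lt (lt_of_le_of_lt (le_of_eq ?_) (tsum_lintegral_piece_lt_top hη h0 hf))
      refine tsum_congr fun j => lintegral_congr fun ξ => ?_
      rw [enorm_mul, ← ofReal_norm, norm_cexp_inner, ENNReal.ofReal_one, one_mul]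
  rw [h1]
  exact enorm_tsum_le_tsum_enorm

/-- The dilation by `(2π)⁻¹` turns the kernel `e^{2πi ⟨x, ξ⟩}` into `e^{i ⟨x, ξ⟩}`, and it preserves
null sets. -/
theorem invFourier_ae_eq {f : L2} (hf : Integrable f) :
    invFourier f =ᵐ[volume] fun y => ((2 * Real.pi : ℝ) ^ 3 : ℂ)⁻¹ * osc f y := by
  have hpi : (2 * Real.pi)⁻¹ ≠ 0 := by positivity
  have h1 := (Measure.quasiMeasurePreserving_smul (volume : Measure SpaceTime) hpi).ae
    (Lp.fourierInv_ae_eq_of_integrable f hf)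
  filter_upwards [h1] with y hy
  rw [invFourier, hy, Real.fourierInv_eq']
  congr 1
  refine integral_congr_ae (.of_forall fun ξ => ?_)
  simp only [smul_eq_mul]
  congr 2
  rw [inner_smul_right, real_inner_comm, mul_comm Complex.I]
  congr 2
  field_simp

/-! ### The maximal estimate in `X_k` -/

/-- The maximal function estimate in `X_k`. -/
theorem mixedNorm_two_top_le_normX (he : ‖e‖ = 1) {η : ℝ → ℝ} (hη : IsCutoff η) {f : L2} {k : ℕ}
    (h0 : ∀ᵐ y, y ∉ regionDTop k → f y = 0) (hf : normX η f < ∞) :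
    mixedNorm 2 ∞ e ({y : SpaceTime | y.snd ∈ Icc (-2 : ℝ) 2}.indicator (invFourier f)) ≤
      ENNReal.ofReal 819200 ^ (1 / 2 : ℝ) * (2 : ℝ≥0∞) ^ ((k : ℝ) / 2) *
        ((k : ℝ≥0∞) + 1) * normX η f := by
  have hintg := integrable_of_normX_lt_top hη h0 hf
  have hpint : ∀ j, Integrable (piece η f j) := fun j => integrable_of_box (by positivity)
    (memLp_piece hη (Lp.memLp f) j) (piece_eq_zero_of_notMem_box hη h0 j)
  have hae : {y : SpaceTime | y.snd ∈ Icc (-2 : ℝ) 2}.indicator (invFourier f) =ᵐ[volume]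
      {y : SpaceTime | y.snd ∈ Icc (-2 : ℝ) 2}.indicator
        fun y => ((2 * Real.pi : ℝ) ^ 3 : ℂ)⁻¹ * osc f y := by
    filter_upwards [invFourier_ae_eq hintg] with y hy
    by_cases h : y ∈ {y : SpaceTime | y.snd ∈ Icc (-2 : ℝ) 2}
    · rw [indicator_of_mem h, indicator_of_mem h, hy]
    · rw [indicator_of_notMem h, indicator_of_notMem h]
  have hc : ‖((2 * Real.pi : ℝ) ^ 3 : ℂ)⁻¹‖ₑ ≤ 1 := by
    rw [← ofReal_norm, ← ENNReal.ofReal_one]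
    refine ENNReal.ofReal_le_ofReal ?_
    rw [norm_inv, norm_pow, Complex.norm_real, Real.norm_of_nonneg (by positivity)]
    exact inv_le_one_of_one_le₀ (one_le_pow₀ (by linarith [Real.pi_gt_three]))
  rw [mixedNorm_congr_ae he hae, mixedNorm_eq]
  calc _ ≤ eLpNorm (fun r => ∑' j, maximalFn e (piece η f j) r) 2 volume := by
        refine eLpNorm_mono_enorm fun r => ?_
        simp only [enorm_eq_self]
        rw [eLpNorm_exponent_top]
        refine eLpNormEssSup_le_of_ae_enorm_bound (.of_forall fun z => ?_)
        by_cases h : z.2 ∈ Icc (-2 : ℝ) 2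
        · rw [indicator_of_mem (by exact h), enorm_mul]
          refine (mul_le_of_le_one_left zero_le hc).trans
            ((enorm_osc_le_tsum hη h0 hf _).trans (ENNReal.tsum_le_tsum fun j => ?_))
          exact enorm_osc_le_maximalFn (hpint j) r z.1 h
        · rw [indicator_of_notMem (by exact h), enorm_zero]
          exact zero_le
    _ ≤ ∑' j, eLpNorm (maximalFn e (piece η f j)) 2 volume :=
        eLpNorm_two_tsum_le fun j => measurable_maximalFn (hpint j)
    _ ≤ ∑' j : ℕ, ENNReal.ofReal 819200 ^ (1 / 2 : ℝ) * (2 : ℝ≥0∞) ^ ((k : ℝ) / 2) *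
        ((k : ℝ≥0∞) + 1) * ((2 : ℝ≥0∞) ^ ((j : ℝ) / 2) * eLpNorm (piece η f j) 2 volume) := by
        refine ENNReal.tsum_le_tsum fun j => ?_
        refine (eLpNorm_maximalFn_le he k (by positivity) (memLp_piece hη (Lp.memLp f) j)
          (piece_eq_zero_of_notMem_box hη h0 j)).trans ?_
        rw [← mul_assoc _ ((2 : ℝ≥0∞) ^ ((j : ℝ) / 2))]
        gcongr
        -- Here `δ = 2 * 2 ^ j`. The square root gives `2^{k/2} 2^{j/2} (k + 1)^{1/2}`, and the last
        -- factor is relaxed to `k + 1`.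
        have h1 : (409600 * (2 * 2 ^ j) * 2 ^ k * (k + 1) : ℝ) =
            819200 * (2 ^ k * ((k + 1) * 2 ^ j)) := by ring
        rw [h1, ENNReal.ofReal_mul (by norm_num), ENNReal.ofReal_mul (by positivity),
          ENNReal.ofReal_mul (by positivity), ENNReal.mul_rpow_of_nonneg _ _ (by norm_num),
          ENNReal.mul_rpow_of_nonneg _ _ (by norm_num),
          ENNReal.mul_rpow_of_nonneg _ _ (by norm_num), ofReal_two_pow_rpow_half,
          ofReal_two_pow_rpow_half, mul_assoc, mul_assoc]
        gcongr
        have h2 : ENNReal.ofReal ((k : ℝ) + 1) = (k : ℝ≥0∞) + 1 := by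
          rw [ENNReal.ofReal_add (by positivity) (by norm_num)]
          simp
        rw [h2]
        calc ((k : ℝ≥0∞) + 1) ^ (1 / 2 : ℝ) ≤ ((k : ℝ≥0∞) + 1) ^ (1 : ℝ) :=
              ENNReal.rpow_le_rpow_of_exponent_le le_add_self (by norm_num)
          _ = _ := ENNReal.rpow_one _
    _ = _ := by rw [ENNReal.tsum_mul_left, ← normX_eq]

end

end MaximalEstimate

/-! ### Duality for `L^{1,2}_e` -/

theorem lintegral_enorm_mul_le_eLpNorm {X : Type*} [MeasurableSpace X] {μ : Measure X}
    {f g : X → ℂ} (hf : AEStronglyMeasurable f μ) (hg : AEStronglyMeasurable g μ) :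
    ∫⁻ x, ‖f x‖ₑ * ‖g x‖ₑ ∂μ ≤ eLpNorm f 2 μ * eLpNorm g 2 μ := by
  rw [← ENNReal.pow_le_pow_left_iff two_ne_zero, mul_pow, eLpNorm_two_sq, eLpNorm_two_sq]
  exact sq_lintegral_mul_le hf.enorm hg.enorm

theorem eLpNorm_comp_smul {E F : Type*} [NormedAddCommGroup E] [NormedSpace ℝ E]
    [MeasurableSpace E] [BorelSpace E] [FiniteDimensional ℝ E] (μ : Measure E)
    [μ.IsAddHaarMeasure] [TopologicalSpace F] [ContinuousENorm F] {p : ℝ≥0∞} (hp : p ≠ ∞)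
    {a : ℝ} (ha : a ≠ 0) (f : E → F) :
    eLpNorm (fun x => f (a • x)) p μ =
      ENNReal.ofReal |(a ^ Module.finrank ℝ E)⁻¹| ^ (1 / p).toReal * eLpNorm f p μ := by
  have h := (Homeomorph.smulOfNeZero a ha).measurableEmbedding.eLpNorm_map_measure
    (μ := μ) (g := f) (p := p)
  have h2 : Measure.map (Homeomorph.smulOfNeZero a ha) μ =
      ENNReal.ofReal |(a ^ Module.finrank ℝ E)⁻¹| • μ := Measure.map_addHaar_smul μ ha
  rw [h2, eLpNorm_smul_measure_of_ne_top hp, smul_eq_mul] at h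
  exact h.symm

/-- Plancherel's identity on `ℝ × ℝ`. -/
theorem eLpNorm_integral_cexp_prod {g : ℝ × ℝ → ℂ} (hg : Integrable g) (hg2 : MemLp g 2 volume) :
    eLpNorm (fun z : ℝ × ℝ => ∫ q : ℝ × ℝ,
      Complex.exp (((2 * Real.pi * (q.1 * z.1 + q.2 * z.2) : ℝ) : ℂ) * Complex.I) * g q) 2 volume =
      eLpNorm g 2 volume := by
  -- The product `ℝ × ℝ` carries the sup norm, so the identity is transported from its Euclidean
  -- version.
  have hto : MeasurePreserving (WithLp.toLp 2 : ℝ × ℝ → WithLp 2 (ℝ × ℝ)) :=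
    WithLp.volume_preserving_toLp ℝ ℝ
  have hemb : MeasurableEmbedding (WithLp.toLp 2 : ℝ × ℝ → WithLp 2 (ℝ × ℝ)) :=
    (MeasurableEquiv.toLp 2 (ℝ × ℝ)).measurableEmbedding
  have hof : MeasurePreserving (WithLp.ofLp : WithLp 2 (ℝ × ℝ) → ℝ × ℝ) :=
    WithLp.volume_preserving_ofLp ℝ ℝ
  have h1 := eLpNorm_fourierInv_eq (V := WithLp 2 (ℝ × ℝ)) (f := fun q => g (WithLp.ofLp q))
    (hof.integrable_comp_of_integrable hg) (hg2.comp_measurePreserving hof)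
  rw [← hto.map_eq, hemb.eLpNorm_map_measure, hto.map_eq,
    ← hto.map_eq, hemb.eLpNorm_map_measure] at h1
  refine Eq.trans (eLpNorm_congr_ae (.of_forall fun z => ?_)) h1
  simp only [Function.comp_apply]
  rw [Real.fourierInv_eq', ← hto.integral_comp hemb]
  refine integral_congr_ae (.of_forall fun q => ?_)
  simp [WithLp.prod_inner_apply, mul_comm]

namespace MaximalEstimate

noncomputable section

variable {e : Plane}

theorem fourierInv_coord (he : ‖e‖ = 1) {ψ : SpaceTime → ℂ} (hψ : Integrable ψ) (r : ℝ)
    (z : ℝ × ℝ) :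
    𝓕⁻ ψ (coord e (r, z)) = ∫ q : ℝ × ℝ,
      Complex.exp (((2 * Real.pi * (q.1 * z.1 + q.2 * z.2) : ℝ) : ℂ) * Complex.I) *
        ∫ s : ℝ, Complex.exp (((2 * Real.pi * (s * r) : ℝ) : ℂ) * Complex.I) *
          ψ (coord e (s, q)) := by
  have hintg : Integrable (fun p : ℝ × (ℝ × ℝ) =>
      Complex.exp (((2 * Real.pi * inner ℝ (coord e p) (coord e (r, z)) : ℝ) : ℂ) * Complex.I) *
        ψ (coord e p)) (volume.prod volume) := by
    have h1 : Integrable (ψ ∘ coord e) :=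
      (measurePreserving_coord he).integrable_comp_of_integrable hψ
    refine h1.norm.mono' (AEStronglyMeasurable.mul (Continuous.aestronglyMeasurable ?_) h1.1)
      (.of_forall fun p => ?_)
    · have := continuous_coord e
      fun_prop
    · rw [norm_mul, Complex.norm_exp_ofReal_mul_I, one_mul]
      rfl
  rw [Real.fourierInv_eq', ← (measurePreserving_coord he).integral_comp
    (measurableEmbedding_coord he)]
  simp only [smul_eq_mul]
  rw [Measure.volume_eq_prod, integral_prod_symm _ hintg]
  refine integral_congr_ae (.of_forall fun q => ?_)
  simp only
  rw [← integral_const_mul]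
  refine integral_congr_ae (.of_forall fun s => ?_)
  simp only
  rw [← mul_assoc, ← Complex.exp_add, inner_coord_coord he]
  congr 2
  push_cast
  ring

/-- For fixed `r`, Plancherel in the two remaining variables reduces the norm to that of the partial
transform along `e`, and Cauchy-Schwarz on a slice of length at most `A` bounds the latter. -/
theorem eLpNorm_fourierInv_slice_le (he : ‖e‖ = 1) {ψ : SpaceTime → ℂ} (hψm : StronglyMeasurable ψ)
    (hψ : Integrable ψ) (hψ2 : MemLp ψ 2 volume) {A : ℝ≥0∞} (hA : A ≠ ∞) {R : Set SpaceTime}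
    (hR : MeasurableSet R) (hψR : ∀ y ∉ R, ψ y = 0)
    (hslice : ∀ z, volume {s : ℝ | coord e (s, z) ∈ R} ≤ A) (r : ℝ) :
    eLpNorm (fun z : ℝ × ℝ => 𝓕⁻ ψ (coord e (r, z))) 2 volume ^ 2 ≤ A * eLpNorm ψ 2 volume ^ 2 := by
  set g : ℝ × ℝ → ℂ := fun q => ∫ s : ℝ,
    Complex.exp (((2 * Real.pi * (s * r) : ℝ) : ℂ) * Complex.I) * ψ (coord e (s, q)) with hg
  have h1 : Integrable (ψ ∘ coord e) (volume.prod volume) :=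
    (measurePreserving_coord he).integrable_comp_of_integrable hψ
  have hgi : Integrable g := by
    refine Integrable.integral_prod_right (f := fun p : ℝ × (ℝ × ℝ) =>
      Complex.exp (((2 * Real.pi * (p.1 * r) : ℝ) : ℂ) * Complex.I) * ψ (coord e p)) ?_
    refine h1.norm.mono' (AEStronglyMeasurable.mul (Continuous.aestronglyMeasurable ?_) h1.1)
      (.of_forall fun p => ?_)
    · fun_prop
    · rw [norm_mul, Complex.norm_exp_ofReal_mul_I, one_mul]
      rfl
  have hmeas : Measurable fun p : ℝ × (ℝ × ℝ) => ‖ψ (coord e p)‖ₑ :=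
    (hψm.measurable.comp (continuous_coord e).measurable).enorm
  have hpt : ∀ q, ‖g q‖ₑ ^ 2 ≤ A * ∫⁻ s, ‖ψ (coord e (s, q))‖ₑ ^ 2 := fun q => by
    have hS : MeasurableSet {s : ℝ | coord e (s, q) ∈ R} :=
      ((continuous_coord e).measurable.comp measurable_prodMk_right) hR
    have h2 : ‖g q‖ₑ ≤ ∫⁻ s, {s : ℝ | coord e (s, q) ∈ R}.indicator (fun _ => 1) s *
        ‖ψ (coord e (s, q))‖ₑ := by
      refine (enorm_integral_le_lintegral_enorm _).trans (lintegral_mono fun s => ?_)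
      simp only
      rw [enorm_mul, ← ofReal_norm (Complex.exp _), Complex.norm_exp_ofReal_mul_I,
        ENNReal.ofReal_one, one_mul]
      by_cases h : s ∈ {s : ℝ | coord e (s, q) ∈ R}
      · rw [indicator_of_mem h, one_mul]
      · rw [hψR _ h, enorm_zero]
        exact zero_le
    have h3 : ∫⁻ s, {s : ℝ | coord e (s, q) ∈ R}.indicator (fun _ => (1 : ℝ≥0∞)) s ^ 2 ≤ A := by
      refine le_trans (le_of_eq ?_) (hslice q)
      rw [← one_mul (volume _), ← lintegral_indicator_const hS]
      refine lintegral_congr fun s => ?_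
      by_cases h : s ∈ {s : ℝ | coord e (s, q) ∈ R}
      · rw [indicator_of_mem h, one_pow]
      · rw [indicator_of_notMem h, zero_pow two_ne_zero]
    calc ‖g q‖ₑ ^ 2 ≤ _ := pow_le_pow_left' h2 2
      _ ≤ _ := sq_lintegral_mul_le (measurable_const.indicator hS).aemeasurable
          (hmeas.comp measurable_prodMk_right).aemeasurable
      _ ≤ _ := mul_le_mul_left h3 _
  have hg2 : eLpNorm g 2 volume ^ 2 ≤ A * eLpNorm ψ 2 volume ^ 2 := by
    rw [eLpNorm_two_sq, eLpNorm_two_sq]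
    calc ∫⁻ q, ‖g q‖ₑ ^ 2 ≤ ∫⁻ q, A * ∫⁻ s, ‖ψ (coord e (s, q))‖ₑ ^ 2 := lintegral_mono hpt
      _ = A * ∫⁻ q, ∫⁻ s, ‖ψ (coord e (s, q))‖ₑ ^ 2 := lintegral_const_mul' _ _ hA
      _ = A * ∫⁻ y, ‖ψ y‖ₑ ^ 2 := by
          congr 1
          rw [← (measurePreserving_coord he).lintegral_comp_emb (measurableEmbedding_coord he)
            (fun y => ‖ψ y‖ₑ ^ 2)]
          exact (lintegral_prod_symm _ (hmeas.pow_const 2).aemeasurable).symm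
  have hgm : MemLp g 2 volume := by
    refine ⟨hgi.1, ?_⟩
    have h4 : eLpNorm g 2 volume ^ 2 < ∞ :=
      hg2.trans_lt (ENNReal.mul_lt_top hA.lt_top (ENNReal.pow_lt_top hψ2.2))
    exact (ENNReal.pow_lt_top_iff.1 h4).resolve_right two_ne_zero
  simp_rw [fourierInv_coord he hψ]
  rw [eLpNorm_integral_cexp_prod hgi hgm]
  exact hg2

/-- The restriction of a function to a set with short slices in the direction `e` is controlled by
the `L^{1,2}_e` norm of its inverse Fourier transform. -/
theorem eLpNorm_indicator_le_mixedNorm (he : ‖e‖ = 1) (H : L2) {R : Set SpaceTime}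
    (hR : MeasurableSet R) (hRfin : volume R ≠ ∞) {A : ℝ≥0∞} (hA : A ≠ ∞)
    (hslice : ∀ z, volume {s : ℝ | coord e (s, z) ∈ R} ≤ A) :
    eLpNorm (R.indicator H) 2 volume ≤
      A ^ (1 / 2 : ℝ) * mixedNorm 1 2 e (𝓕⁻ H : L2) := by
  set ψ : SpaceTime → ℂ := R.indicator H with hψ
  have hψm : StronglyMeasurable ψ := (Lp.stronglyMeasurable H).indicator hR
  have hψ2 : MemLp ψ 2 volume := (Lp.memLp H).indicator hR
  have hψ1 : Integrable ψ := by
    have : IsFiniteMeasure (volume.restrict R) := ⟨by simpa using hRfin.lt_top⟩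
    exact (integrable_indicator_iff hR).2 (((Lp.memLp H).restrict R).integrable one_le_two)
  set Ψ : L2 := hψ2.toLp with hΨ
  have hae : Ψ =ᵐ[volume] ψ := hψ2.coeFn_toLp
  have hΨF : (𝓕⁻ Ψ : L2) =ᵐ[volume] 𝓕⁻ ψ := by
    filter_upwards [Lp.fourierInv_ae_eq_of_integrable Ψ ((integrable_congr hae).2 hψ1)] with y hy
    rw [hy]
    exact Real.fourierInv_congr_ae hae y
  set U : L2 := 𝓕⁻ H with hU
  have hcont : Continuous (𝓕⁻ ψ) :=
    VectorFourier.fourierIntegral_continuous Real.continuous_fourierChar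
      (by simp only [LinearMap.neg_apply, innerₗ_apply_apply]; fun_prop) hψ1
  have hUm : Measurable U := (Lp.stronglyMeasurable U).measurable
  have hcm := (continuous_coord e).measurable
  set N := eLpNorm ψ 2 volume with hN
  have hslice2 : ∀ r, eLpNorm (fun z : ℝ × ℝ => 𝓕⁻ ψ (coord e (r, z))) 2 volume ≤
      A ^ (1 / 2 : ℝ) * N := fun r => by
    rw [← ENNReal.pow_le_pow_left_iff two_ne_zero, mul_pow, ← ENNReal.rpow_two (_ ^ (1 / 2 : ℝ)),
      ← ENNReal.rpow_mul]
    norm_num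
    exact eLpNorm_fourierInv_slice_le he hψm hψ1 hψ2 hA hR
      (fun y hy => indicator_of_notMem hy _) hslice r
  have hinner : N ^ 2 = ‖inner ℂ Ψ H‖ₑ := by
    rw [hN, eLpNorm_two_sq, ← enorm_integral_conj_mul_self hψ2, L2.inner_def]
    congr 1
    refine integral_congr_ae ?_
    filter_upwards [hae] with y hy
    rw [RCLike.inner_apply, hy, mul_comm]
    by_cases h : y ∈ R
    · rw [hψ, indicator_of_mem h]
    · rw [hψ, indicator_of_notMem h]
      simp
  have hmain : N ^ 2 ≤ (A ^ (1 / 2 : ℝ) * mixedNorm 1 2 e U) * N := by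
    -- Since `ψ` is a restriction of `H`, `‖ψ‖² = ⟨ψ, H⟩`. Plancherel moves this to the physical
    -- side, where one factor is bounded in `L^{∞,2}_e` and the other is measured in `L^{1,2}_e`.
    calc N ^ 2 = ‖inner ℂ (𝓕⁻ Ψ : L2) U‖ₑ := by rw [hinner, hU, Lp.inner_fourierInv_eq]
      _ ≤ ∫⁻ y, ‖𝓕⁻ ψ y‖ₑ * ‖U y‖ₑ := by
          rw [L2.inner_def]
          refine (enorm_integral_le_lintegral_enorm _).trans (le_of_eq (lintegral_congr_ae ?_))
          filter_upwards [hΨF] with y hy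
          rw [RCLike.inner_apply, enorm_mul, RCLike.enorm_conj, hy, mul_comm]
      _ = ∫⁻ r, ∫⁻ z, ‖𝓕⁻ ψ (coord e (r, z))‖ₑ * ‖U (coord e (r, z))‖ₑ := by
          rw [← (measurePreserving_coord he).lintegral_comp_emb (measurableEmbedding_coord he),
            Measure.volume_eq_prod, lintegral_prod]
          exact ((hcont.measurable.comp hcm).enorm.mul (hUm.comp hcm).enorm).aemeasurable
      _ ≤ ∫⁻ r, (A ^ (1 / 2 : ℝ) * N) * eLpNorm (fun z => U (coord e (r, z))) 2 volume := by
          refine lintegral_mono fun r => ?_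
          refine (lintegral_enorm_mul_le_eLpNorm
            (hcont.measurable.comp (hcm.comp measurable_prodMk_left)).aestronglyMeasurable
            (hUm.comp (hcm.comp measurable_prodMk_left)).aestronglyMeasurable).trans ?_
          exact mul_le_mul_left (hslice2 r) _
      _ = (A ^ (1 / 2 : ℝ) * N) * mixedNorm 1 2 e U := by
          rw [lintegral_const_mul' _ _ (ENNReal.mul_ne_top
            (ENNReal.rpow_ne_top_of_nonneg (by norm_num) hA) hψ2.2.ne), mixedNorm_eq,
            eLpNorm_one_eq_lintegral_enorm]
          rfl
      _ = _ := by ring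
  by_cases hN0 : N = 0
  · rw [hN0]
    exact zero_le
  · rw [sq] at hmain
    exact (ENNReal.mul_le_mul_iff_left hN0 hψ2.2.ne).1 hmain

/-- With `a = (2π)⁻¹`, the normalization contributes `a³` and the dilation `a⁻¹` from each of the
inner `L²` norm in two variables and the outer `L¹` norm in one, leaving `a`. -/
theorem mixedNorm_one_two_invFourier (e : Plane) (H : L2) :
    mixedNorm 1 2 e (𝓕⁻ H : L2) = ENNReal.ofReal (2 * Real.pi) * mixedNorm 1 2 e (invFourier H) := by
  set a : ℝ := (2 * Real.pi)⁻¹ with ha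
  have ha0 : 0 < a := by positivity
  set U : L2 := 𝓕⁻ H with hU
  set c : ℂ := ((2 * Real.pi : ℝ) ^ 3 : ℂ)⁻¹ with hc
  have hcn : ‖c‖ₑ = ENNReal.ofReal (a ^ 3) := by
    rw [hc, ← ofReal_norm, norm_inv, norm_pow, Complex.norm_real,
      Real.norm_of_nonneg (by positivity), ha, inv_pow]
  set φ : ℝ → ℝ≥0∞ := fun r => eLpNorm (fun z : ℝ × ℝ => U (coord e (r, z))) 2 volume with hφ
  have hinner : ∀ r, eLpNorm (fun z : ℝ × ℝ => invFourier H (coord e (r, z))) 2 volume =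
      ENNReal.ofReal (a ^ 2) * φ (a • r) := fun r => by
    have h1 : (fun z : ℝ × ℝ => invFourier H (coord e (r, z))) =
        c • fun z : ℝ × ℝ => U (coord e (a • r, a • z)) := by
      ext z
      simp only [invFourier, Pi.smul_apply, smul_eq_mul]
      rw [← coord_smul]
      rfl
    have h5 : eLpNorm (fun z : ℝ × ℝ => U (coord e (a • r, a • z))) 2 volume =
        ENNReal.ofReal |(a ^ Module.finrank ℝ (ℝ × ℝ))⁻¹| ^ (1 / 2 : ℝ≥0∞).toReal * φ (a • r) :=
      eLpNorm_comp_smul volume (by norm_num) ha0.ne' fun z => U (coord e (a • r, z))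
    rw [h1, eLpNorm_const_smul, h5, hcn, ← mul_assoc]
    congr 1
    have h2 : Module.finrank ℝ (ℝ × ℝ) = 2 := by simp
    rw [h2, abs_of_pos (by positivity), ENNReal.ofReal_rpow_of_pos (by positivity),
      ← ENNReal.ofReal_mul (by positivity)]
    congr 1
    have h3 : (1 / 2 : ℝ≥0∞).toReal = 1 / 2 := by simp
    rw [h3, ← Real.sqrt_eq_rpow, ← inv_pow, Real.sqrt_sq (by positivity)]
    field_simp
  have h4 : mixedNorm 1 2 e (invFourier H) = ENNReal.ofReal a * mixedNorm 1 2 e U := by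
    rw [mixedNorm_eq, mixedNorm_eq]
    simp_rw [hinner]
    rw [eLpNorm_one_eq_lintegral_enorm]
    simp only [enorm_eq_self]
    rw [lintegral_const_mul' _ _ ENNReal.ofReal_ne_top]
    have h5 := eLpNorm_comp_smul (volume : Measure ℝ) ENNReal.one_ne_top ha0.ne' φ
    rw [eLpNorm_one_eq_lintegral_enorm] at h5
    simp only [enorm_eq_self] at h5
    rw [h5, ← mul_assoc]
    congr 1
    simp only [Module.finrank_self, pow_one, div_one, ENNReal.toReal_one, ENNReal.rpow_one]
    rw [abs_of_pos (by positivity), ← ENNReal.ofReal_mul (by positivity)]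
    congr 1
    field_simp
  rw [h4, ← mul_assoc, ← ENNReal.ofReal_mul (by positivity), ha, mul_inv_cancel₀ (by positivity),
    ENNReal.ofReal_one, one_mul]

/-! ### Slices of the frequency region and the embedding of `Y_k^e` in `X_k` -/

/-- The part of `box R δ` on which `|ξ · conj e| ≥ m`. -/
def dirBox (e : Plane) (R δ m : ℝ) : Set SpaceTime :=
  {y ∈ box R δ | m ≤ |inner ℝ y.fst (conj e)|}

theorem measurableSet_dirBox (e : Plane) (R δ m : ℝ) : MeasurableSet (dirBox e R δ m) := by
  have h : IsClosed {y : SpaceTime | m ≤ |inner ℝ y.fst (conj e)|} :=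
    isClosed_le continuous_const (by fun_prop)
  exact (measurableSet_box R δ).inter h.measurableSet

/-- Along `e` the symbol is a polynomial of degree at most two in `s` with derivative `2 ξ · conj
e`, so its difference quotient is the mean of the derivatives at the endpoints. -/
theorem symb_coord_sub (e : Plane) (s s' : ℝ) (z : ℝ × ℝ) :
    symb (coord e (s', z)) - symb (coord e (s, z)) =
      (s' - s) * (inner ℝ (coord e (s, z)).fst (conj e) +
        inner ℝ (coord e (s', z)).fst (conj e)) := by
  simp only [symb, coord_fst_zero, coord_fst_one, coord_snd, PiLp.inner_apply, Fin.sum_univ_two,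
    conj]
  simp
  ring

/-- The slice splits according to the sign of `ξ · conj e`. On each part the two terms in
`symb_coord_sub` add up without cancellation to at least `2 m`, while the symbol varies by at most
`2 δ`; the diameter is thus at most `δ / m`. -/
theorem volume_slice_le (e : Plane) {R δ m : ℝ} (hδ : 0 ≤ δ) (hm : 0 < m) (z : ℝ × ℝ) :
    volume {s : ℝ | coord e (s, z) ∈ dirBox e R δ m} ≤ ENNReal.ofReal (2 * δ / m) := by
  set d : ℝ → ℝ := fun s => inner ℝ (coord e (s, z)).fst (conj e) with hd
  have key : ∀ S : Set ℝ, (∀ s ∈ S, ∀ s' ∈ S, 2 * m ≤ |d s + d s'|) →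
      (∀ s ∈ S, |symb (coord e (s, z))| ≤ δ) → volume S ≤ ENNReal.ofReal (δ / m) := by
    intro S hS hSδ
    refine (Real.volume_le_diam S).trans (Metric.ediam_le fun s hs s' hs' => ?_)
    rw [edist_dist]
    refine ENNReal.ofReal_le_ofReal ?_
    rw [dist_comm, Real.dist_eq, le_div_iff₀ hm]
    have h1 : |s' - s| * |d s + d s'| ≤ 2 * δ := by
      rw [← abs_mul, ← symb_coord_sub e s s' z]
      have h2 := abs_sub (symb (coord e (s', z))) (symb (coord e (s, z)))
      linarith [hSδ s hs, hSδ s' hs']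
    nlinarith [mul_le_mul_of_nonneg_left (hS s hs s' hs') (abs_nonneg (s' - s))]
  have hcover : {s : ℝ | coord e (s, z) ∈ dirBox e R δ m} ⊆
      {s | |symb (coord e (s, z))| ≤ δ ∧ m ≤ d s} ∪
        {s | |symb (coord e (s, z))| ≤ δ ∧ m ≤ -d s} := by
    intro s hs
    rcases le_abs.1 hs.2 with h | h
    · exact Or.inl ⟨hs.1.2, h⟩
    · exact Or.inr ⟨hs.1.2, h⟩
  refine (measure_mono hcover).trans ((measure_union_le _ _).trans ?_)
  have hsum : ENNReal.ofReal (2 * δ / m) = ENNReal.ofReal (δ / m) + ENNReal.ofReal (δ / m) := by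
    rw [← ENNReal.ofReal_add (by positivity) (by positivity)]
    congr 1
    ring
  rw [hsum]
  refine add_le_add (key _ ?_ fun s hs => hs.1) (key _ ?_ fun s hs => hs.1)
  · intro s hs s' hs'
    refine le_trans ?_ (le_abs_self _)
    linarith [hs.2, hs'.2]
  · intro s hs s' hs'
    refine le_trans ?_ (neg_le_abs _)
    linarith [hs.2, hs'.2]

theorem volume_slice_le_diam (he : ‖e‖ = 1) {R δ m : ℝ} (hR : 0 ≤ R) (z : ℝ × ℝ) :
    volume {s : ℝ | coord e (s, z) ∈ dirBox e R δ m} ≤ ENNReal.ofReal (2 * R) := by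
  calc _ ≤ volume (Icc (-R) R) := by
        refine measure_mono fun s hs => ?_
        have h1 := norm_sq_coord_fst he (s, z)
        have h2 : ‖(coord e (s, z)).fst‖ ^ 2 ≤ R ^ 2 := pow_le_pow_left₀ (norm_nonneg _) hs.1.1 2
        exact abs_le.1 (abs_le_of_sq_le_sq (by nlinarith [sq_nonneg z.1]) hR)
    _ = _ := by
        rw [Real.volume_Icc]
        congr 1
        ring

/-- The derivative bound is better for `j ≤ 2 k`, the trivial bound by the diameter of the frequency
ball beyond; the truncated exponent `j - 2 * k` records both. -/
theorem volume_slice_dyadic_le (he : ‖e‖ = 1) (k j : ℕ) (z : ℝ × ℝ) :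
    volume {s : ℝ | coord e (s, z) ∈ dirBox e (2 * 2 ^ k) (2 * 2 ^ j) (2 ^ k / 4)} ≤
      ENNReal.ofReal (16 * (2 ^ j / 2 ^ k) * (1 / 2) ^ (j - 2 * k)) := by
  rcases le_total j (2 * k) with h | h
  · refine (volume_slice_le e (by positivity) (by positivity) z).trans
      (ENNReal.ofReal_le_ofReal (le_of_eq ?_))
    rw [Nat.sub_eq_zero_of_le h]
    field_simp
    norm_num
  · refine (volume_slice_le_diam he (by positivity) z).trans (ENNReal.ofReal_le_ofReal ?_)
    obtain ⟨i, rfl⟩ := Nat.exists_eq_add_of_le h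
    have h1 : (2 : ℝ) ^ (2 * k + i) = 2 ^ k * 2 ^ k * 2 ^ i := by rw [pow_add, two_mul, pow_add]
    have h2 : (1 / 2 : ℝ) ^ (2 * k + i - 2 * k) = 1 / 2 ^ i := by
      rw [Nat.add_sub_cancel_left, one_div_pow]
    rw [h1, h2]
    have h3 : 16 * (2 ^ k * 2 ^ k * 2 ^ i / 2 ^ k) * (1 / 2 ^ i) = 16 * (2 : ℝ) ^ k := by field_simp
    rw [h3]
    linarith [pow_pos (two_pos (α := ℝ)) k]

theorem eLpNorm_piece_le (he : ‖e‖ = 1) {η : ℝ → ℝ} (hη : IsCutoff η) {k : ℕ} (hk : k ≠ 0) {f : L2}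
    (h0 : ∀ᵐ y, y ∉ regionDTopDir k e → f y = 0) (H : L2)
    (hH : ∀ᵐ y, H y = ((symb y : ℂ) + Complex.I) * f y) (j : ℕ) :
    eLpNorm (piece η f j) 2 volume ≤ ENNReal.ofReal (4 / 2 ^ j) *
      (ENNReal.ofReal (16 * (2 ^ j / 2 ^ k) * (1 / 2) ^ (j - 2 * k)) ^ (1 / 2 : ℝ) *
        mixedNorm 1 2 e (𝓕⁻ H : L2)) := by
  set R := dirBox e (2 * 2 ^ k) (2 * 2 ^ j) (2 ^ k / 4) with hR
  have hRfin : volume R ≠ ∞ :=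
    ne_top_of_le_ne_top ENNReal.ofReal_ne_top
      ((measure_mono fun y hy => hy.1).trans (volume_box_le (by positivity)))
  have hdual := eLpNorm_indicator_le_mixedNorm he H (measurableSet_dirBox _ _ _ _) hRfin
    ENNReal.ofReal_ne_top (volume_slice_dyadic_le he k j)
  have hpt : ∀ᵐ y, ‖piece η f j y‖ ≤ 4 / 2 ^ j * ‖R.indicator H y‖ := by
    filter_upwards [h0, hH] with y hy0 hyH
    by_cases h1 : f y = 0
    · rw [piece, h1, mul_zero, norm_zero]
      positivity
    by_cases h2 : dyadic η j (symb y) = 0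
    · rw [piece, h2, Complex.ofReal_zero, zero_mul, norm_zero]
      positivity
    have hreg : y ∈ regionDTopDir k e := by
      by_contra h
      exact h1 (hy0 h)
    have hyR : y ∈ R := by
      refine ⟨⟨norm_fst_le_of_mem_regionDTop hreg.1, abs_le_of_dyadic_ne_zero hη h2⟩, ?_⟩
      -- The threshold `2 ^ k / 4` is half of the lower bound `2 ^ k / 2` for `|ξ|`.
      have h3 := le_norm_fst_of_mem_regionDTop hk hreg.1
      refine le_trans ?_ hreg.2
      linarith
    have h4 : max 1 |symb y| ≤ ‖(symb y : ℂ) + Complex.I‖ := by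
      refine max_le ?_ ?_
      · simpa using Complex.abs_im_le_norm ((symb y : ℂ) + Complex.I)
      · simpa using Complex.abs_re_le_norm ((symb y : ℂ) + Complex.I)
    have h5 : (2 : ℝ) ^ j ≤ 4 * ‖(symb y : ℂ) + Complex.I‖ :=
      (two_pow_le_of_dyadic_ne_zero hη h2).trans (by linarith)
    rw [indicator_of_mem hyR, hyH, piece, norm_mul, norm_mul, Complex.norm_real, ← mul_assoc]
    refine mul_le_mul_of_nonneg_right ?_ (norm_nonneg _)
    refine (abs_dyadic_le_one hη j _).trans ?_
    rw [div_mul_eq_mul_div, le_div_iff₀ (by positivity), one_mul]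
    exact h5
  exact (eLpNorm_le_mul_eLpNorm_of_ae_le_mul hpt 2).trans (mul_le_mul_right hdual _)

theorem normX_zero (η : ℝ → ℝ) : normX η 0 = 0 := by
  rw [normX_eq]
  refine ENNReal.tsum_eq_zero.2 fun j => ?_
  have h1 : piece η (0 : L2) j =ᵐ[volume] 0 := by
    filter_upwards [Lp.coeFn_zero ℂ 2 (volume : Measure SpaceTime)] with y hy
    rw [piece, hy, Pi.zero_apply, mul_zero]
  rw [eLpNorm_congr_ae h1, eLpNorm_zero, mul_zero]

/-- The constant of the embedding of `Y_k^e` in `X_k`. -/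
def embeddingConst : ℝ≥0∞ :=
  ENNReal.ofReal (32 * Real.pi) * (2 + (1 - ENNReal.ofReal (1 / 2) ^ (1 / 2 : ℝ))⁻¹)

theorem embeddingConst_ne_top : embeddingConst ≠ ∞ := by
  have h : ENNReal.ofReal (1 / 2) ^ (1 / 2 : ℝ) < 1 :=
    ENNReal.rpow_lt_one (by simp) (by norm_num)
  refine ENNReal.mul_ne_top ENNReal.ofReal_ne_top (ENNReal.add_ne_top.2 ⟨by norm_num, ?_⟩)
  rw [ENNReal.inv_ne_top]
  exact (tsub_pos_of_lt h).ne'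

/-- The weight `2^{j/2}`, the gain `2^{-j}` from `P + i` and the root `2^{(j-k)/2}` of the slice
length multiply to `2^{-k/2}`, the normalization of `Y_k^e`. No decay in `j` is left until `j > 2
k`, so the sum has size `k + 1`. -/
theorem normX_le_of_mem_spaceY (he : ‖e‖ = 1) {η : ℝ → ℝ} (hη : IsCutoff η) {k : ℕ} {f : L2}
    (hf : f ∈ spaceY k e) : normX η f ≤ embeddingConst * ((k : ℝ≥0∞) + 1) * normY k e f := by
  by_cases hk : 100 ≤ k
  swap
  · rw [spaceY, if_neg hk] at hf
    rw [mem_singleton_iff.1 hf]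
    rw [normX_zero]
    exact zero_le
  rw [spaceY, if_pos hk] at hf
  obtain ⟨h0, hY⟩ := hf
  unfold normY at hY ⊢
  split_ifs at hY ⊢ with hmem
  swap
  · exact absurd hY (lt_irrefl _)
  set M := mixedNorm 1 2 e (invFourier hmem.toLp)
  set ρ := ENNReal.ofReal (1 / 2) ^ (1 / 2 : ℝ) with hρ
  have hterm : ∀ j : ℕ, (2 : ℝ≥0∞) ^ ((j : ℝ) / 2) * eLpNorm (piece η f j) 2 volume ≤
      (ENNReal.ofReal (32 * Real.pi) * ((2 : ℝ≥0∞) ^ (-(k : ℝ) / 2) * M)) * ρ ^ (j - 2 * k) := by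
    intro j
    have h1 := eLpNorm_piece_le he hη (by omega) h0 hmem.toLp hmem.coeFn_toLp j
    rw [mixedNorm_one_two_invFourier] at h1
    refine (mul_le_mul_right h1 _).trans (le_of_eq ?_)
    have h2 : (2 : ℝ≥0∞) ^ ((j : ℝ) / 2) = ENNReal.ofReal (2 ^ ((j : ℝ) / 2)) := by
      rw [← ENNReal.ofReal_rpow_of_pos two_pos, ENNReal.ofReal_ofNat]
    have h3 : (2 : ℝ≥0∞) ^ (-(k : ℝ) / 2) = ENNReal.ofReal (2 ^ (-(k : ℝ) / 2)) := by
      rw [← ENNReal.ofReal_rpow_of_pos two_pos, ENNReal.ofReal_ofNat]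
    have h4 : ENNReal.ofReal (16 * (2 ^ j / 2 ^ k) * (1 / 2) ^ (j - 2 * k)) ^ (1 / 2 : ℝ) =
        ENNReal.ofReal (4 * (2 ^ ((j : ℝ) / 2) * 2 ^ (-(k : ℝ) / 2))) * ρ ^ (j - 2 * k) := by
      rw [ENNReal.ofReal_mul (by positivity), ENNReal.mul_rpow_of_nonneg _ _ (by norm_num), hρ,
        ENNReal.ofReal_pow (by norm_num), ← ENNReal.rpow_natCast, ← ENNReal.rpow_natCast,
        ← ENNReal.rpow_mul, ← ENNReal.rpow_mul, mul_comm (1 / 2 : ℝ),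
        ENNReal.ofReal_rpow_of_pos (by positivity)]
      congr 2
      rw [← Real.sqrt_eq_rpow, Real.sqrt_eq_iff_mul_self_eq (by positivity) (by positivity)]
      have h5 : (2 : ℝ) ^ ((j : ℝ) / 2) * 2 ^ ((j : ℝ) / 2) = 2 ^ j := by
        rw [← Real.rpow_add two_pos, ← Real.rpow_natCast]
        congr 1
        ring
      have h6 : (2 : ℝ) ^ (-(k : ℝ) / 2) * 2 ^ (-(k : ℝ) / 2) = (2 ^ k)⁻¹ := by
        rw [← Real.rpow_add two_pos, ← Real.rpow_natCast, ← Real.rpow_neg two_pos.le]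
        congr 1
        ring
      rw [div_eq_mul_inv, ← h5, ← h6]
      ring
    have h7 : ENNReal.ofReal (2 ^ ((j : ℝ) / 2)) * ENNReal.ofReal (4 / 2 ^ j) *
        ENNReal.ofReal (4 * (2 ^ ((j : ℝ) / 2) * 2 ^ (-(k : ℝ) / 2))) *
          ENNReal.ofReal (2 * Real.pi) =
        ENNReal.ofReal (32 * Real.pi) * ENNReal.ofReal (2 ^ (-(k : ℝ) / 2)) := by
      rw [← ENNReal.ofReal_mul (by positivity), ← ENNReal.ofReal_mul (by positivity),
        ← ENNReal.ofReal_mul (by positivity), ← ENNReal.ofReal_mul (by positivity)]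
      congr 1
      have h5 : (2 : ℝ) ^ ((j : ℝ) / 2) * 2 ^ ((j : ℝ) / 2) = 2 ^ j := by
        rw [← Real.rpow_add two_pos, ← Real.rpow_natCast]
        congr 1
        ring
      rw [← h5]
      have h8 : (2 : ℝ) ^ ((j : ℝ) / 2) ≠ 0 := by positivity
      field_simp
      norm_num
    rw [h2, h3, h4, ← mul_assoc (ENNReal.ofReal (32 * Real.pi)), ← h7]
    ring
  rw [normX_eq]
  refine (ENNReal.tsum_le_tsum hterm).trans ?_
  rw [ENNReal.tsum_mul_left]
  calc _ ≤ (ENNReal.ofReal (32 * Real.pi) * ((2 : ℝ≥0∞) ^ (-(k : ℝ) / 2) * M)) *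
        ((2 + (1 - ρ)⁻¹) * ((k : ℝ≥0∞) + 1)) := by
        refine mul_le_mul_right ((tsum_pow_sub_le ρ (2 * k)).trans ?_) _
        push_cast
        rw [add_mul, mul_add, mul_add, mul_one, mul_one]
        exact add_le_add le_self_add le_add_self
    _ = _ := by
        rw [embeddingConst]
        ring

/-! ### The sum space `Z_k` and the conclusion -/

theorem normX_add_le {η : ℝ → ℝ} (hη : IsCutoff η) (f g : L2) :
    normX η (f + g) ≤ normX η f + normX η g := by
  simp_rw [normX_eq]
  rw [← ENNReal.tsum_add]
  refine ENNReal.tsum_le_tsum fun j => ?_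
  rw [← mul_add]
  refine mul_le_mul_right ?_ _
  have h1 : piece η (f + g : L2) j =ᵐ[volume] piece η f j + piece η g j := by
    filter_upwards [Lp.coeFn_add f g] with y hy
    simp only [piece, Pi.add_apply, hy]
    ring
  rw [eLpNorm_congr_ae h1]
  exact eLpNorm_add_le (aestronglyMeasurable_piece hη (Lp.aestronglyMeasurable f) j)
    (aestronglyMeasurable_piece hη (Lp.aestronglyMeasurable g) j) one_le_two

theorem norm_circle1 (e : Circle1) : ‖(e : Plane)‖ = 1 :=
  mem_sphere_zero_iff_norm.1 e.2

theorem normX_le_of_isDecomp {η : ℝ → ℝ} (hη : IsCutoff η) {L : ℕ} {ev : Fin L → Circle1} {k : ℕ}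
    {f f₀ : L2} {fl : Fin L → L2} (h : IsDecomp η ev k f f₀ fl) :
    normX η f ≤ (1 + embeddingConst) * ((k : ℝ≥0∞) + 1) *
      (normX η f₀ + ∑ l, normY k (ev l) (fl l)) := by
  obtain ⟨h0, hl, rfl⟩ := h
  have h1 : normX η (∑ l, fl l) ≤ ∑ l, normX η (fl l) :=
    Finset.le_sum_of_subadditive (normX η) (normX_zero η).le (normX_add_le hη) _ _
  have hk : 1 ≤ (k : ℝ≥0∞) + 1 := le_add_self
  have hC : embeddingConst ≤ 1 + embeddingConst := le_add_self
  have hone : 1 ≤ (1 + embeddingConst) * ((k : ℝ≥0∞) + 1) := by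
    calc (1 : ℝ≥0∞) = 1 * 1 := (one_mul 1).symm
      _ ≤ _ := mul_le_mul' le_self_add hk
  calc normX η (f₀ + ∑ l, fl l) ≤ normX η f₀ + ∑ l, normX η (fl l) :=
        (normX_add_le hη _ _).trans (add_le_add le_rfl h1)
    _ ≤ (1 + embeddingConst) * ((k : ℝ≥0∞) + 1) * normX η f₀ +
        ∑ l, (1 + embeddingConst) * ((k : ℝ≥0∞) + 1) * normY k (ev l) (fl l) := by
        refine add_le_add ?_ (Finset.sum_le_sum fun l _ => ?_)
        · calc normX η f₀ = 1 * normX η f₀ := (one_mul _).symm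
            _ ≤ _ := mul_le_mul_left hone _
        · refine (normX_le_of_mem_spaceY (norm_circle1 _) hη (hl l)).trans ?_
          gcongr
    _ = _ := by rw [← Finset.mul_sum, ← mul_add]

theorem ae_eq_zero_of_isDecomp {η : ℝ → ℝ} {L : ℕ} {ev : Fin L → Circle1} {k : ℕ}
    {f f₀ : L2} {fl : Fin L → L2} (h : IsDecomp η ev k f f₀ fl) :
    ∀ᵐ y : SpaceTime, y ∉ regionDTop k → f y = 0 := by
  obtain ⟨h0, hl, rfl⟩ := h
  have h1 : ∀ l, ∀ᵐ y : SpaceTime, y ∉ regionDTop k → fl l y = 0 := fun l => by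
    have hY := hl l
    by_cases hk : 100 ≤ k
    · rw [spaceY, if_pos hk] at hY
      filter_upwards [hY.1] with y hy hyk
      exact hy fun h => hyk h.1
    · rw [spaceY, if_neg hk] at hY
      rw [mem_singleton_iff.1 hY]
      filter_upwards [Lp.coeFn_zero ℂ 2 (volume : Measure SpaceTime)] with y hy _
      exact hy
  filter_upwards [h0.1, ae_all_iff.2 h1, Lp.coeFn_add f₀ (∑ l, fl l),
    Lp.coeFn_finsetSum Finset.univ fl] with y hy0 hyl hadd hsum hyk
  rw [hadd, Pi.add_apply, hy0 hyk, hsum, zero_add, Finset.sum_apply]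
  exact Finset.sum_eq_zero fun l _ => hyl l hyk

theorem normX_lt_top_of_isDecomp {η : ℝ → ℝ} (hη : IsCutoff η) {L : ℕ} {ev : Fin L → Circle1}
    {k : ℕ} {f f₀ : L2} {fl : Fin L → L2} (h : IsDecomp η ev k f f₀ fl) : normX η f < ∞ := by
  obtain ⟨h0, hl, rfl⟩ := h
  have h1 : normX η (∑ l, fl l) ≤ ∑ l, normX η (fl l) :=
    Finset.le_sum_of_subadditive (normX η) (normX_zero η).le (normX_add_le hη) _ _
  refine (normX_add_le hη _ _).trans_lt (ENNReal.add_lt_top.2 ⟨h0.2, h1.trans_lt ?_⟩)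
  refine ENNReal.sum_lt_top.2 fun l _ => ?_
  have hY := hl l
  by_cases hk : 100 ≤ k
  · refine (normX_le_of_mem_spaceY (norm_circle1 _) hη hY).trans_lt ?_
    rw [spaceY, if_pos hk] at hY
    exact ENNReal.mul_lt_top (ENNReal.mul_lt_top embeddingConst_ne_top.lt_top (by finiteness)) hY.2
  · rw [spaceY, if_neg hk] at hY
    rw [mem_singleton_iff.1 hY, normX_zero]
    exact ENNReal.zero_lt_top

end

end MaximalEstimate

open MaximalEstimate in
theorem lemma3p7 (η : ℝ → ℝ) (hη : IsCutoff η) {L : ℕ} (ev : Fin L → Circle1)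
    (hev : IsDirectionNet ev) :
    ∃ C : ℝ≥0, ∀ (k : ℕ) (e : Circle1) (f : L2), f ∈ spaceZ η ev k →
      mixedNorm 2 ∞ e ({y : SpaceTime | y.snd ∈ Icc (-2 : ℝ) 2}.indicator (invFourier f)) ≤
        C * (2 : ℝ≥0∞) ^ ((k : ℝ) / 2) * ((k : ℝ≥0∞) + 1) ^ 2 * normZ η ev k f := by
  have hA : ENNReal.ofReal 819200 ^ (1 / 2 : ℝ) ≠ ∞ :=
    ENNReal.rpow_ne_top_of_nonneg (by norm_num) ENNReal.ofReal_ne_top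
  have hA0 : ENNReal.ofReal 819200 ^ (1 / 2 : ℝ) ≠ 0 := by
    rw [← pos_iff_ne_zero]
    exact ENNReal.rpow_pos (by simp) ENNReal.ofReal_ne_top
  have hB : 1 + embeddingConst ≠ ∞ := ENNReal.add_ne_top.2 ⟨ENNReal.one_ne_top, embeddingConst_ne_top⟩
  have hC := ENNReal.mul_ne_top hA hB
  refine ⟨(ENNReal.ofReal 819200 ^ (1 / 2 : ℝ) * (1 + embeddingConst)).toNNReal,
    fun k e f ⟨g₀, gl, hg⟩ => ?_⟩
  rw [ENNReal.coe_toNNReal hC]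
  have hX := mixedNorm_two_top_le_normX (norm_circle1 e) hη (ae_eq_zero_of_isDecomp hg)
    (normX_lt_top_of_isDecomp hη hg)
  have h2 : (2 : ℝ≥0∞) ^ ((k : ℝ) / 2) ≠ ∞ :=
    ENNReal.rpow_ne_top_of_nonneg (by positivity) ENNReal.ofNat_ne_top
  have h20 : (2 : ℝ≥0∞) ^ ((k : ℝ) / 2) ≠ 0 := by
    rw [← pos_iff_ne_zero]
    exact ENNReal.rpow_pos (by norm_num) ENNReal.ofNat_ne_top
  have hk : ((k : ℝ≥0∞) + 1) ^ 2 ≠ ∞ := by finiteness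
  -- Dividing by the constant, which is neither `0` nor `∞`, isolates the infimum. The decomposition
  -- `g₀`, `gl` only served to place `f` in `X_k`; the bound is now checked for an arbitrary one.
  rw [← ENNReal.div_le_iff' (by
      refine mul_ne_zero (mul_ne_zero (mul_ne_zero hA0 ?_) h20) ?_ <;> simp)
    (ENNReal.mul_ne_top (ENNReal.mul_ne_top hC h2) hk)]
  refine le_iInf fun f₀ => le_iInf fun fl => le_iInf fun h => ?_
  refine ENNReal.div_le_of_le_mul' (hX.trans ?_)
  refine (mul_le_mul_right (normX_le_of_isDecomp hη h) _).trans (le_of_eq ?_)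
  ring
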